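/- Let $(x,y)$ be null coordinates near the origin of the Lorentz plane $\mathbb R^{1,1}$. An analytic map $N$ from an open set of $\mathbb R^{1,1}$ into the unit sphere $\mathbb S^2\subset\mathbb R^3$ is Lorentzian-harmonic if $N\times N_{xy}=0$. Consider germs at the origin of analytic Lorentzian-harmonic maps $N$ into $\mathbb S^2$ with $N(0,0)=(0,0,1)$; call them normalized germs. Every normalized germ can be written near the origin as $N=\delta\,(u,v,1)$, where $\delta=(1+u^2+v^2)^{-1/2}$ and $u=N_1/N_3$, $v=N_2/N_3$ are analytic at the origin and vanish there. Write the $n$-jets of $u$ and $v$ at the origin as $j^nu=\sum_{k=1}^n\sum_{i=0}^k a_{ki}x^{k-i}y^i$ and $j^nv=\sum_{k=1}^n\sum_{i=0}^k b_{ki}x^{k-i}y^i$. The $n$-jet of $N$ is the pair $(j^nu,j^nv)$. **Theorem.** There are real polynomials $P_{ki}(a,b)$ ($k\ge 3$, $1\le i\le k-1$) in the variables $a=(a_{l0},a_{ll})_{1\le l\le k-2}$, $b=(b_{l0},b_{ll})_{1\le l\le k-2}$, independent of $n$ and of the map, such that for every $n\ge 0$ the following hold. 1. For every normalized germ, $$j^nu=\sum_{k=1}^n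 a_{k0}x^k+\sum_{k=1}^n a_{kk}y^k+\sum_{k=3}^n\sum_{i=1}^{k-1}P_{ki}(a,b)\,x^{k-i}y^i,$$ $$j^nv=\sum_{k=1}^n b_{k0}x^k+\sum_{k=1}^n b_{kk}y^k+\sum_{k=3}^n\sum_{i=1}^{k-1}P_{ki}(b,a)\,x^{k-i}y^i .$$ In particular $a_{21}=b_{21}=0$, and all mixed coefficients are determined polynomially by the pure ones. 2. For any real numbers $(a_{i0})_{1\le i\le n}$, $(a_{ii})_{1\le i\le n}$, $(b_{i0})_{1\le i\le n}$, $(b_{ii})_{1\le i\le n}$ there is a normalized germ whose pure coefficients up to degree $n$ are exactly these numbers and whose $n$-jet is the pair of polynomials displayed in 1. 3. The map sending $(a_{i0},a_{ii},b_{i0},b_{ii})_{1\le i\le n}\in\mathbb R^{4n}$ to the pair of polynomials displayed in 1 is a bijection from $\mathbb R^{4n}$ onto the set of $n$-jets of normalized germs. -/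

import Mathlib

open scoped Topology Matrix

noncomputable section

/-- The first partial derivative `f_x` of a map of two real variables `(x, y)`. -/
def partialX {E : Type*} [NormedAddCommGroup E] [NormedSpace ℝ E] (f : ℝ × ℝ → E) : ℝ × ℝ → E :=
  fun p => fderiv ℝ f p (1, 0)

/-- The first partial derivative `f_y` of a map of two real variables `(x, y)`. -/
def partialY {E : Type*} [NormedAddCommGroup E] [NormedSpace ℝ E] (f : ℝ × ℝ → E) : ℝ × ℝ → E :=
  fun p => fderiv ℝ f p (0, 1)

/-- `N` is an analytic Lorentzian-harmonic map from the open set `Ω` of the Lorentz plane, with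
null coordinates `(x, y)`, into the unit sphere of Euclidean 3-space: `N × N_xy = 0` on `Ω`.
(A null coordinate change is `(x, y) ↦ (X x, Y y)`, up to exchanging the coordinates, so the
equation does not depend on the null coordinates.) -/
structure IsAnalyticLorentzianHarmonicOn (N : ℝ × ℝ → EuclideanSpace ℝ (Fin 3))
    (Ω : Set (ℝ × ℝ)) : Prop where
  isOpen : IsOpen Ω
  analytic : AnalyticOnNhd ℝ N Ω
  mem_sphere : ∀ p ∈ Ω, N p ∈ Metric.sphere (0 : EuclideanSpace ℝ (Fin 3)) 1
  harmonic : ∀ p ∈ Ω, (N p).ofLp ⨯₃ (partialY (partialX N) p).ofLp = 0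

/-- `N` represents a germ at the origin of an analytic Lorentzian-harmonic map into the sphere,
with the normalization `N (0, 0) = (0, 0, 1)`. -/
def IsNormalizedHarmonicGerm (N : ℝ × ℝ → EuclideanSpace ℝ (Fin 3)) : Prop :=
  (∃ Ω : Set (ℝ × ℝ), (0, 0) ∈ Ω ∧ IsAnalyticLorentzianHarmonicOn N Ω) ∧ N (0, 0) = !₂[0, 0, 1]

/-- The function `u` in `N = δ (u, v, 1)`. -/
def affineU (N : ℝ × ℝ → EuclideanSpace ℝ (Fin 3)) : ℝ × ℝ → ℝ := fun p => N p 0 / N p 2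

/-- The function `v` in `N = δ (u, v, 1)`. -/
def affineV (N : ℝ × ℝ → EuclideanSpace ℝ (Fin 3)) : ℝ × ℝ → ℝ := fun p => N p 1 / N p 2

/-- The map `δ (u, v, 1)`, where `δ = (1 + u ^ 2 + v ^ 2) ^ (-1 / 2)`. -/
def sphereMap (u v : ℝ × ℝ → ℝ) : ℝ × ℝ → EuclideanSpace ℝ (Fin 3) :=
  fun p => (Real.sqrt (1 + u p ^ 2 + v p ^ 2))⁻¹ • !₂[u p, v p, 1]

/-- The coefficient of `x ^ (k - i) * y ^ i` (where `i ≤ k`) in the Taylor expansion of `f` at the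
origin. -/
def taylorCoeff (f : ℝ × ℝ → ℝ) (k i : ℕ) : ℝ :=
  partialX^[k - i] (partialY^[i] f) (0, 0) / ((k - i).factorial * i.factorial : ℝ)

/-- The `n`-jet of `f` at the origin, i.e. its Taylor polynomial of degree `n` in the variables
`x = X 0` and `y = X 1`. -/
def jet (n : ℕ) (f : ℝ × ℝ → ℝ) : MvPolynomial (Fin 2) ℝ :=
  ∑ k ∈ Finset.range (n + 1), ∑ i ∈ Finset.range (k + 1),
    MvPolynomial.C (taylorCoeff f k i) * MvPolynomial.X 0 ^ (k - i) * MvPolynomial.X 1 ^ i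

/-- The `n`-jet at the origin of the map `N = δ (u, v, 1)`, in the coordinates `(u, v)`. -/
def jetPair (n : ℕ) (N : ℝ × ℝ → EuclideanSpace ℝ (Fin 3)) :
    MvPolynomial (Fin 2) ℝ × MvPolynomial (Fin 2) ℝ :=
  (jet n (affineU N), jet n (affineV N))

/-- The space of `n`-jets of the normalized germs of analytic Lorentzian-harmonic maps. -/
def jetSpace (n : ℕ) : Set (MvPolynomial (Fin 2) ℝ × MvPolynomial (Fin 2) ℝ) :=
  {J | ∃ N, IsNormalizedHarmonicGerm N ∧ jetPair n N = J}

/-- The parameter space `ℝ^{4n}`. The entry `c s j` of a parameter `c` stands for `a_{l0}`,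
`a_{ll}`, `b_{l0}`, `b_{ll}` for `s = 0, 1, 2, 3` respectively, where `l = j + 1`. -/
abbrev PureParams (n : ℕ) : Type := Fin 4 → Fin n → ℝ

/-- The parameters indexed by `(s, l)` with `1 ≤ l ≤ n`, extended by zero to all other `l`. -/
def PureParams.val {n : ℕ} (c : PureParams n) (q : Fin 4 × ℕ) : ℝ :=
  if h : 1 ≤ q.2 ∧ q.2 ≤ n then c q.1 ⟨q.2 - 1, by omega⟩ else 0

/-- The exchange of `a` and `b`. -/
def PureParams.swap {n : ℕ} (c : PureParams n) : PureParams n := ![c 2, c 3, c 0, c 1]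

/-- The pure `x`- and pure `y`-Taylor coefficients, up to degree `n`, of `u` and `v`. -/
def pureCoeffs (n : ℕ) (N : ℝ × ℝ → EuclideanSpace ℝ (Fin 3)) : PureParams n :=
  ![fun j => taylorCoeff (affineU N) (j + 1) 0,
    fun j => taylorCoeff (affineU N) (j + 1) (j + 1),
    fun j => taylorCoeff (affineV N) (j + 1) 0,
    fun j => taylorCoeff (affineV N) (j + 1) (j + 1)]

/-- The polynomial
`∑_{k=1}^n a_{k0} x^k + ∑_{k=1}^n a_{kk} y^k + ∑_{k=3}^n ∑_{i=1}^{k-1} P_{ki}(a,b) x^{k-i} y^i`. -/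
def normalForm (P : ℕ → ℕ → MvPolynomial (Fin 4 × ℕ) ℝ) (n : ℕ) (c : PureParams n) :
    MvPolynomial (Fin 2) ℝ :=
  (∑ k ∈ Finset.Icc 1 n, MvPolynomial.C (c.val (0, k)) * MvPolynomial.X 0 ^ k)
    + (∑ k ∈ Finset.Icc 1 n, MvPolynomial.C (c.val (1, k)) * MvPolynomial.X 1 ^ k)
    + ∑ k ∈ Finset.Icc 3 n, ∑ i ∈ Finset.Icc 1 (k - 1),
        MvPolynomial.C (MvPolynomial.eval c.val (P k i))
          * MvPolynomial.X 0 ^ (k - i) * MvPolynomial.X 1 ^ i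

/-- The pair of `n`-jets of `u` and `v` with parameters `c = (a, b)`: the second one arises from
the first by exchanging `a` and `b`. -/
def normalFormPair (P : ℕ → ℕ → MvPolynomial (Fin 4 × ℕ) ℝ) (n : ℕ) (c : PureParams n) :
    MvPolynomial (Fin 2) ℝ × MvPolynomial (Fin 2) ℝ :=
  (normalForm P n c, normalForm P n c.swap)

end

noncomputable section

/-! ### Convolution of double sequences -/

/-! Since N = δ(u, v, 1) and N₃ ≠ 0, the vector N × N_xy vanishes exactly when (1 + u² + v²) u_xy =
2 u u_x u_y + v (v_x u_y + v_y u_x) and the same equation with u and v exchanged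
(`cross_eq_zero_iff`). Multiplying by xy turns every derivative into an Euler operator x∂x or y∂y.
Comparing coefficients then gives mn · a(m,n) = cubic expression in the Taylor coefficients of u and
v (`taylor_eq_harmonicStep`).

Because u and v vanish at the origin, each of the three factors has degree at least 1, hence at most
m + n - 2. So the pure coefficients are free and the mixed ones are determined recursively and
polynomially (`eq_harmonicSolution`). The recursion makes sense over every real algebra: solved with
indeterminates as pure coefficients it yields the polynomials P, with the bound l ≤ k - 2 on their
variables (`harmonicSolution_mem_supported`), and evaluation is an algebra homomorphism
(`map_harmonicSolution`).

For existence, finitely many pure coefficients are prescribed and the others set to zero. The Euler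
weights in the cubic are at most mn, which the division by mn cancels. The weighted ℓ¹ norm S of the
iterates therefore obeys S_{K+1} ≤ ε + 12 S_K³, and stays bounded once the weight makes ε small
(`exists_weightedSum_harmonicIter_le`). The formal solution thus converges, and its sum solves the
equations. The exchange of u and v is carried by `swapData`, so a single recursion serves both
functions. -/

instance : Finset.HasAntidiagonal (ℕ × ℕ) where
  antidiagonal p := (Finset.HasAntidiagonal.antidiagonal p.1 ×ˢ
    Finset.HasAntidiagonal.antidiagonal p.2).map
    (Equiv.prodProdProdComm ℕ ℕ ℕ ℕ).toEmbedding
  mem_antidiagonal := by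
    rintro ⟨m, n⟩ ⟨⟨a, b⟩, ⟨c, d⟩⟩
    simp [Prod.ext_iff]

/-- The convolution of double sequences, i.e. the product of formal power series in two
variables. -/
def conv {R : Type*} [CommSemiring R] (a b : ℕ × ℕ → R) (p : ℕ × ℕ) : R :=
  ∑ q ∈ Finset.HasAntidiagonal.antidiagonal p, a q.1 * b q.2

theorem sum_antidiagonal_prod {R : Type*} [AddCommMonoid R] (f : (ℕ × ℕ) × (ℕ × ℕ) → R) (m n : ℕ) :
    ∑ q ∈ Finset.HasAntidiagonal.antidiagonal (m, n), f q =
      ∑ i ∈ Finset.HasAntidiagonal.antidiagonal m,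
        ∑ j ∈ Finset.HasAntidiagonal.antidiagonal n, f ((i.1, j.1), (i.2, j.2)) := by
  change ∑ q ∈ (Finset.HasAntidiagonal.antidiagonal m ×ˢ Finset.HasAntidiagonal.antidiagonal n).map
    (Equiv.prodProdProdComm ℕ ℕ ℕ ℕ).toEmbedding, f q = _
  rw [Finset.sum_map, Finset.sum_product]
  rfl

section conv

variable {R : Type*} [CommRing R]

/-- The Euler operator x∂x is a derivation: the exponent of x is additive over the two factors. -/
theorem fst_mul_conv (a b : ℕ × ℕ → R) (p : ℕ × ℕ) :
    (p.1 : R) * conv a b p = conv (fun q => q.1 * a q) b p + conv a (fun q => q.1 * b q) p := by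
  unfold conv
  rw [Finset.mul_sum, ← Finset.sum_add_distrib]
  refine Finset.sum_congr rfl fun q hq => ?_
  rw [← Finset.HasAntidiagonal.mem_antidiagonal.1 hq, Prod.fst_add]
  push_cast
  ring

theorem snd_mul_conv (a b : ℕ × ℕ → R) (p : ℕ × ℕ) :
    (p.2 : R) * conv a b p = conv (fun q => q.2 * a q) b p + conv a (fun q => q.2 * b q) p := by
  unfold conv
  rw [Finset.mul_sum, ← Finset.sum_add_distrib]
  refine Finset.sum_congr rfl fun q hq => ?_
  rw [← Finset.HasAntidiagonal.mem_antidiagonal.1 hq, Prod.snd_add]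
  push_cast
  ring

theorem conv_comm (a b : ℕ × ℕ → R) : conv a b = conv b a := by
  funext p
  unfold conv
  refine Finset.sum_nbij' Prod.swap Prod.swap ?_ ?_ (fun _ _ => rfl) (fun _ _ => rfl)
    (fun _ _ => mul_comm _ _) <;>
  · intro q hq
    rw [Finset.HasAntidiagonal.mem_antidiagonal] at hq ⊢
    rw [← hq, Prod.fst_swap, Prod.snd_swap, add_comm]

/-- By `ha` the series of `a` is divisible by x, and the factor x can be pulled out of the product.
-/
theorem conv_succ_fst (a b : ℕ × ℕ → R) (ha : ∀ n, a (0, n) = 0) (m n : ℕ) :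
    conv a b (m + 1, n) = conv (fun q => a (q.1 + 1, q.2)) b (m, n) := by
  unfold conv
  rw [sum_antidiagonal_prod, sum_antidiagonal_prod, Finset.Nat.sum_antidiagonal_succ]
  simp [ha]

theorem conv_succ_snd (a b : ℕ × ℕ → R) (ha : ∀ m, a (m, 0) = 0) (m n : ℕ) :
    conv a b (m, n + 1) = conv (fun q => a (q.1, q.2 + 1)) b (m, n) := by
  unfold conv
  rw [sum_antidiagonal_prod, sum_antidiagonal_prod]
  refine Finset.sum_congr rfl fun i _ => ?_
  rw [Finset.Nat.sum_antidiagonal_succ]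
  simp [ha]

theorem conv_zero_zero (a b : ℕ × ℕ → R) : conv a b (0, 0) = a (0, 0) * b (0, 0) := by
  unfold conv
  rw [sum_antidiagonal_prod]
  simp

end conv

/-! ### Partial derivatives of analytic functions -/

section partials

variable {E : Type*} [NormedAddCommGroup E] [NormedSpace ℝ E] {f g : ℝ × ℝ → E} {p : ℝ × ℝ}

theorem AnalyticAt.partialX [CompleteSpace E] (hf : AnalyticAt ℝ f p) :
    AnalyticAt ℝ (partialX f) p :=
  ((ContinuousLinearMap.apply ℝ E ((1, 0) : ℝ × ℝ)).analyticAt _).comp hf.fderiv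

theorem AnalyticAt.partialY [CompleteSpace E] (hf : AnalyticAt ℝ f p) :
    AnalyticAt ℝ (partialY f) p :=
  ((ContinuousLinearMap.apply ℝ E ((0, 1) : ℝ × ℝ)).analyticAt _).comp hf.fderiv

theorem Filter.EventuallyEq.partialX (h : f =ᶠ[𝓝 p] g) : partialX f =ᶠ[𝓝 p] partialX g :=
  (h.fderiv (𝕜 := ℝ)).mono fun q hq => by simp only [_root_.partialX, hq]

theorem Filter.EventuallyEq.partialY (h : f =ᶠ[𝓝 p] g) : partialY f =ᶠ[𝓝 p] partialY g :=
  (h.fderiv (𝕜 := ℝ)).mono fun q hq => by simp only [_root_.partialY, hq]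

theorem partialX_add (hf : AnalyticAt ℝ f p) (hg : AnalyticAt ℝ g p) :
    partialX (f + g) p = partialX f p + partialX g p := by
  simp [partialX, fderiv_add hf.differentiableAt hg.differentiableAt]

theorem partialY_add (hf : AnalyticAt ℝ f p) (hg : AnalyticAt ℝ g p) :
    partialY (f + g) p = partialY f p + partialY g p := by
  simp [partialY, fderiv_add hf.differentiableAt hg.differentiableAt]

theorem partialX_const (c : E) : partialX (fun _ => c) = fun _ => 0 := by
  funext p; simp [partialX]

theorem partialY_const (c : E) : partialY (fun _ => c) = fun _ => 0 := by
  funext p; simp [partialY]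

theorem partialX_partialY [CompleteSpace E] (hf : AnalyticAt ℝ f p) :
    partialX (partialY f) p = partialY (partialX f) p := by
  have h := ContDiffAt.isSymmSndFDerivAt (𝕜 := ℝ) (n := 2) (f := f) (x := p) hf.contDiffAt
    (by simp)
  have hd : DifferentiableAt ℝ (fderiv ℝ f) p :=
    (hf.contDiffAt (n := 2)).fderiv_right (m := 1) (by norm_num) |>.differentiableAt (by simp)
  have key : ∀ v w : ℝ × ℝ, fderiv ℝ (fun q => fderiv ℝ f q v) p w
      = fderiv ℝ (fderiv ℝ f) p w v := by
    intro v w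
    rw [fderiv_clm_apply hd (differentiableAt_const v)]
    simp
  change fderiv ℝ (fun q => fderiv ℝ f q (0, 1)) p (1, 0)
    = fderiv ℝ (fun q => fderiv ℝ f q (1, 0)) p (0, 1)
  rw [key, key]
  exact h _ _

end partials

section partialsMul

variable {f g : ℝ × ℝ → ℝ} {p : ℝ × ℝ}

theorem partialX_mul (hf : AnalyticAt ℝ f p) (hg : AnalyticAt ℝ g p) :
    partialX (f * g) p = partialX f p * g p + f p * partialX g p := by
  simp [partialX, fderiv_mul hf.differentiableAt hg.differentiableAt]
  ring

theorem partialY_mul (hf : AnalyticAt ℝ f p) (hg : AnalyticAt ℝ g p) :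
    partialY (f * g) p = partialY f p * g p + f p * partialY g p := by
  simp [partialY, fderiv_mul hf.differentiableAt hg.differentiableAt]
  ring

theorem partialX_fst : partialX (Prod.fst : ℝ × ℝ → ℝ) = fun _ => 1 := by
  funext p; simp [partialX, fderiv_fst]

theorem partialY_fst : partialY (Prod.fst : ℝ × ℝ → ℝ) = fun _ => 0 := by
  funext p; simp [partialY, fderiv_fst]

theorem partialX_snd : partialX (Prod.snd : ℝ × ℝ → ℝ) = fun _ => 0 := by
  funext p; simp [partialX, fderiv_snd]

theorem partialY_snd : partialY (Prod.snd : ℝ × ℝ → ℝ) = fun _ => 1 := by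
  funext p; simp [partialY, fderiv_snd]

end partialsMul

/-! ### The Taylor expansion at the origin -/

/-- The coefficient of `x ^ p.1 * y ^ p.2` in the Taylor expansion of `f` at the origin. -/
def taylor (f : ℝ × ℝ → ℝ) (p : ℕ × ℕ) : ℝ :=
  partialX^[p.1] (partialY^[p.2] f) (0, 0) / (p.1.factorial * p.2.factorial)

theorem taylorCoeff_eq_taylor (f : ℝ × ℝ → ℝ) (k i : ℕ) :
    taylorCoeff f k i = taylor f (k - i, i) := rfl

section taylor

variable {f g : ℝ × ℝ → ℝ}

theorem AnalyticAt.eventually_of_forall {P : (ℝ × ℝ) → Prop} (hf : AnalyticAt ℝ f (0, 0))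
    (hg : AnalyticAt ℝ g (0, 0)) (h : ∀ p, AnalyticAt ℝ f p → AnalyticAt ℝ g p → P p) :
    ∀ᶠ p in 𝓝 (0, 0), P p := by
  filter_upwards [hf.eventually_analyticAt, hg.eventually_analyticAt] with p h1 h2 using h p h1 h2

theorem taylor_congr (h : f =ᶠ[𝓝 (0, 0)] g) : taylor f = taylor g := by
  have hY : ∀ n, partialY^[n] f =ᶠ[𝓝 (0, 0)] partialY^[n] g := by
    intro n
    induction n with
    | zero => exact h
    | succ n ih => simpa only [Function.iterate_succ_apply'] using ih.partialY
  have hX : ∀ m n, partialX^[m] (partialY^[n] f) =ᶠ[𝓝 (0, 0)] partialX^[m] (partialY^[n] g) := by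
    intro m n
    induction m with
    | zero => exact hY n
    | succ m ih => simpa only [Function.iterate_succ_apply'] using ih.partialX
  funext p
  rw [taylor, taylor, (hX p.1 p.2).eq_of_nhds]

theorem taylor_zero_zero (f : ℝ × ℝ → ℝ) : taylor f (0, 0) = f (0, 0) := by
  simp [taylor]

theorem taylor_partialY (f : ℝ × ℝ → ℝ) (m n : ℕ) :
    taylor (partialY f) (m, n) = (n + 1) * taylor f (m, n + 1) := by
  have h1 : (m.factorial : ℝ) ≠ 0 := by positivity
  have h2 : (n.factorial : ℝ) ≠ 0 := by positivity
  have h3 : (n + 1 : ℝ) ≠ 0 := by positivity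
  simp only [taylor, ← Function.iterate_succ_apply, Nat.factorial_succ]
  push_cast
  field_simp

/-- In `taylor` the y-derivatives act first, so an extra x-derivative has to be commuted past them.
This is possible near the origin, where f is analytic, hence the passage through germs. -/
theorem taylor_partialX (hf : AnalyticAt ℝ f (0, 0)) (m n : ℕ) :
    taylor (partialX f) (m, n) = (m + 1) * taylor f (m + 1, n) := by
  have hA : ∀ n, AnalyticAt ℝ (partialY^[n] f) (0, 0) := by
    intro n
    induction n with
    | zero => exact hf
    | succ n ih => simpa only [Function.iterate_succ_apply'] using ih.partialY
  have hY : ∀ n, partialY^[n] (partialX f) =ᶠ[𝓝 (0, 0)] partialX (partialY^[n] f) := by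
    intro n
    induction n with
    | zero => exact Filter.EventuallyEq.rfl
    | succ n ih =>
      simp only [Function.iterate_succ_apply']
      refine ih.partialY.trans ?_
      filter_upwards [(hA n).eventually_analyticAt] with p hp using (partialX_partialY hp).symm
  have hX : ∀ m, partialX^[m] (partialY^[n] (partialX f))
      =ᶠ[𝓝 (0, 0)] partialX^[m] (partialX (partialY^[n] f)) := by
    intro m
    induction m with
    | zero => exact hY n
    | succ m ih => simpa only [Function.iterate_succ_apply'] using ih.partialX
  have h1 : (m.factorial : ℝ) ≠ 0 := by positivity
  have h2 : (n.factorial : ℝ) ≠ 0 := by positivity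
  have h3 : (m + 1 : ℝ) ≠ 0 := by positivity
  simp only [taylor, (hX m).eq_of_nhds, ← Function.iterate_succ_apply, Nat.factorial_succ]
  push_cast
  field_simp

theorem taylor_succ_fst (hf : AnalyticAt ℝ f (0, 0)) (m n : ℕ) :
    taylor f (m + 1, n) = taylor (partialX f) (m, n) / (m + 1) := by
  rw [taylor_partialX hf, mul_div_cancel_left₀]
  positivity

theorem taylor_succ_snd (f : ℝ × ℝ → ℝ) (m n : ℕ) :
    taylor f (m, n + 1) = taylor (partialY f) (m, n) / (n + 1) := by
  rw [taylor_partialY, mul_div_cancel_left₀]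
  positivity

theorem taylor_add (hf : AnalyticAt ℝ f (0, 0)) (hg : AnalyticAt ℝ g (0, 0)) :
    taylor (f + g) = taylor f + taylor g := by
  funext ⟨m, n⟩
  induction m generalizing f g with
  | zero =>
    induction n generalizing f g with
    | zero => simp [taylor_zero_zero]
    | succ n ih =>
      have := ih hf.partialY hg.partialY
      have h : partialY (f + g) =ᶠ[𝓝 (0, 0)] partialY f + partialY g :=
        hf.eventually_of_forall hg fun p => partialY_add
      simp only [Pi.add_apply] at this ⊢
      rw [taylor_succ_snd, taylor_succ_snd, taylor_succ_snd, taylor_congr h, this, add_div]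
  | succ m ih =>
    have := ih hf.partialX hg.partialX
    have h : partialX (f + g) =ᶠ[𝓝 (0, 0)] partialX f + partialX g :=
      hf.eventually_of_forall hg fun p => partialX_add
    simp only [Pi.add_apply] at this ⊢
    rw [taylor_succ_fst (hf.add hg), taylor_succ_fst hf, taylor_succ_fst hg, taylor_congr h, this,
      add_div]

/-- Both sides obey the Leibniz rule: for functions it is the product rule, for series it is the
derivation property of the Euler operators with one factor x or y cancelled. Induction on the
exponents then compares them. -/
theorem taylor_mul (hf : AnalyticAt ℝ f (0, 0)) (hg : AnalyticAt ℝ g (0, 0)) :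
    taylor (f * g) = conv (taylor f) (taylor g) := by
  funext ⟨m, n⟩
  induction m generalizing f g with
  | zero =>
    induction n generalizing f g with
    | zero => simp [taylor_zero_zero, conv_zero_zero]
    | succ n ih =>
      have h : partialY (f * g) =ᶠ[𝓝 (0, 0)] partialY f * g + f * partialY g :=
        hf.eventually_of_forall hg fun p => partialY_mul
      rw [taylor_succ_snd, taylor_congr h,
        taylor_add (hf.partialY.mul hg) (hf.mul hg.partialY), Pi.add_apply, ih hf.partialY hg,
        ih hf hg.partialY, div_eq_iff (by positivity), mul_comm]
      have := snd_mul_conv (taylor f) (taylor g) (0, n + 1)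
      push_cast at this
      rw [this, conv_comm (taylor f) (taylor (partialY g)),
        conv_comm (taylor f) fun q : ℕ × ℕ => (q.2 : ℝ) * taylor g q,
        conv_succ_snd _ _ (by simp), conv_succ_snd _ _ (by simp)]
      congr 2 <;> funext ⟨a, b⟩ <;> simp [taylor_partialY]
  | succ m ih =>
    have h : partialX (f * g) =ᶠ[𝓝 (0, 0)] partialX f * g + f * partialX g :=
      hf.eventually_of_forall hg fun p => partialX_mul
    rw [taylor_succ_fst (hf.mul hg), taylor_congr h,
      taylor_add (hf.partialX.mul hg) (hf.mul hg.partialX), Pi.add_apply, ih hf.partialX hg,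
      ih hf hg.partialX, div_eq_iff (by positivity), mul_comm]
    have := fst_mul_conv (taylor f) (taylor g) (m + 1, n)
    push_cast at this
    rw [this, conv_comm (taylor f) (taylor (partialX g)),
      conv_comm (taylor f) fun q : ℕ × ℕ => (q.1 : ℝ) * taylor g q,
      conv_succ_fst _ _ (by simp), conv_succ_fst _ _ (by simp)]
    congr 2 <;> funext ⟨a, b⟩ <;> simp [taylor_partialX hf, taylor_partialX hg]

theorem taylor_const (c : ℝ) : taylor (fun _ => c) = fun p => if p = (0, 0) then c else 0 := by
  have h0 : ∀ m n, taylor (fun _ => 0) (m, n) = 0 := by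
    intro m n
    induction m with
    | zero =>
      induction n with
      | zero => exact taylor_zero_zero _
      | succ n ih => rw [taylor_succ_snd, partialY_const, ih, zero_div]
    | succ m ih => rw [taylor_succ_fst analyticAt_const, partialX_const, ih, zero_div]
  funext ⟨m, n⟩
  cases m with
  | zero =>
    cases n with
    | zero => simp [taylor_zero_zero]
    | succ n => simp [taylor_succ_snd, partialY_const, h0]
  | succ m => simp [taylor_succ_fst analyticAt_const, partialX_const, h0]

theorem taylor_const_mul (c : ℝ) (hf : AnalyticAt ℝ f (0, 0)) (p : ℕ × ℕ) :
    taylor (fun q => c * f q) p = c * taylor f p := by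
  have := congrFun (taylor_mul (analyticAt_const (v := c)) hf) p
  rw [taylor_const] at this
  refine this.trans ?_
  unfold conv
  rw [Finset.sum_eq_single ((0, 0), p)]
  · simp
  · rintro ⟨a, b⟩ h hne
    have : a ≠ (0, 0) := by
      rintro rfl
      apply hne
      have := Finset.HasAntidiagonal.mem_antidiagonal.1 h
      simpa [Prod.ext_iff] using this
    simp [this]
  · intro h
    exact absurd (Finset.HasAntidiagonal.mem_antidiagonal.2 (by simp)) h

theorem taylor_fst_mul (hf : AnalyticAt ℝ f (0, 0)) (m n : ℕ) :
    taylor (Prod.fst * f) (m + 1, n) = taylor f (m, n) ∧ taylor (Prod.fst * f) (0, n) = 0 := by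
  have hfst : taylor Prod.fst = fun p : ℕ × ℕ => if p = (1, 0) then (1 : ℝ) else 0 := by
    funext ⟨m, n⟩
    cases m with
    | zero =>
      cases n with
      | zero => simp [taylor_zero_zero]
      | succ n => simp [taylor_succ_snd, partialY_fst, taylor_const]
    | succ m =>
      rw [taylor_succ_fst analyticAt_fst, partialX_fst, taylor_const]
      rcases m with - | m <;> simp [Prod.ext_iff]
  rw [taylor_mul analyticAt_fst hf, hfst]
  constructor
  · rw [conv_succ_fst _ _ (by simp)]
    -- With x divided out, the first factor is the series of the constant 1, which is the unit for
    -- convolution.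
    have := taylor_const_mul 1 hf (m, n)
    rw [show (fun q => 1 * f q) = (fun _ => 1) * f from rfl, taylor_mul analyticAt_const hf,
      taylor_const] at this
    simpa [Prod.ext_iff] using this
  · unfold conv
    rw [sum_antidiagonal_prod]
    simp

theorem taylor_snd_mul (hf : AnalyticAt ℝ f (0, 0)) (m n : ℕ) :
    taylor (Prod.snd * f) (m, n + 1) = taylor f (m, n) ∧ taylor (Prod.snd * f) (m, 0) = 0 := by
  have hsnd : taylor Prod.snd = fun p : ℕ × ℕ => if p = (0, 1) then (1 : ℝ) else 0 := by
    funext ⟨m, n⟩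
    cases m with
    | zero =>
      cases n with
      | zero => simp [taylor_zero_zero]
      | succ n =>
        rw [taylor_succ_snd, partialY_snd, taylor_const]
        rcases n with - | n <;> simp [Prod.ext_iff]
    | succ m => simp [taylor_succ_fst analyticAt_snd, partialX_snd, taylor_const]
  rw [taylor_mul analyticAt_snd hf, hsnd]
  constructor
  · rw [conv_succ_snd _ _ (by simp)]
    have := taylor_const_mul 1 hf (m, n)
    rw [show (fun q => 1 * f q) = (fun _ => 1) * f from rfl, taylor_mul analyticAt_const hf,
      taylor_const] at this
    simpa [Prod.ext_iff] using this
  · unfold conv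
    rw [sum_antidiagonal_prod]
    simp

/-- An analytic function is determined by its Taylor expansion. -/
theorem eventually_eq_zero_of_taylor_eq_zero (hf : AnalyticAt ℝ f (0, 0)) (h : taylor f = 0) :
    ∀ᶠ p in 𝓝 ((0, 0) : ℝ × ℝ), f p = 0 := by
  -- The derivative of f in the direction y is a combination of the two partial derivatives, so its
  -- Taylor coefficients vanish too. Induction on the order kills all iterated derivatives on the
  -- diagonal, which are the terms of the power series of f.
  have key : ∀ (n : ℕ) (f : ℝ × ℝ → ℝ) (y : ℝ × ℝ), AnalyticAt ℝ f (0, 0) → taylor f = 0 →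
      iteratedFDeriv ℝ n f (0, 0) (fun _ => y) = 0 := by
    intro n
    induction n with
    | zero =>
      intro f y hf h
      simp [← taylor_zero_zero, h]
    | succ n ih =>
      intro f y hf h
      rw [iteratedFDeriv_succ_apply_right]
      have h1 : (iteratedFDeriv ℝ n (fun z => fderiv ℝ f z) (0, 0) fun _ => y) y
          = iteratedFDeriv ℝ n (fun z => fderiv ℝ f z y) (0, 0) fun _ => y := by
        have := (ContinuousLinearMap.apply ℝ ℝ y).iteratedFDeriv_comp_left (i := n) (n := n)
          (x := ((0, 0) : ℝ × ℝ)) (f := fderiv ℝ f) hf.fderiv.contDiffAt le_rfl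
        exact (congrArg (fun M => M fun _ => y) this).symm
      refine h1.trans (ih _ y ?_ ?_)
      · exact ((ContinuousLinearMap.apply ℝ ℝ y).analyticAt _).comp hf.fderiv
      · have h2 : (fun z => fderiv ℝ f z y)
            = (fun q => y.1 * partialX f q) + (fun q => y.2 * partialY f q) := by
          funext z
          have : y = y.1 • ((1, 0) : ℝ × ℝ) + y.2 • ((0, 1) : ℝ × ℝ) := by ext <;> simp
          conv_lhs => rw [this]
          rw [map_add, map_smul, map_smul]
          rfl
        have hX : AnalyticAt ℝ (fun q => y.1 * partialX f q) (0, 0) :=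
          analyticAt_const.mul hf.partialX
        have hY : AnalyticAt ℝ (fun q => y.2 * partialY f q) (0, 0) :=
          analyticAt_const.mul hf.partialY
        rw [h2, taylor_add hX hY]
        funext ⟨m, k⟩
        simp [taylor_const_mul _ hf.partialX, taylor_const_mul _ hf.partialY, taylor_partialX hf,
          taylor_partialY, h]
  obtain ⟨p, r, hp⟩ := hf
  filter_upwards [Metric.eball_mem_nhds _ hp.r_pos] with z hz
  have hs := hp.hasSum_iteratedFDeriv (y := z) (by simpa [edist_zero_right, ← Prod.zero_eq_mk] using hz)
  have h0 : ((0 : ℝ), (0 : ℝ)) + z = z := by simp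
  rw [h0] at hs
  refine hs.unique ?_
  simp [key _ f z hp.analyticAt h, hasSum_zero]

end taylor

/-! ### Convergent double power series -/

/-- The formal multilinear series on `ℝ × ℝ` with the homogeneous parts
`∑_{i + j = k} a (i, j) x ^ i y ^ j`. -/
def doubleSeries (a : ℕ × ℕ → ℝ) : FormalMultilinearSeries ℝ (ℝ × ℝ) ℝ := fun k =>
  ∑ q ∈ Finset.HasAntidiagonal.antidiagonal k,
    a q • (ContinuousMultilinearMap.mkPiAlgebra ℝ (Fin k) ℝ).compContinuousLinearMap
      fun j => if j.val < q.1 then ContinuousLinearMap.fst ℝ ℝ ℝ else ContinuousLinearMap.snd ℝ ℝ ℝ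

/-- The first i slots read off x and the others y. The multilinear maps are not symmetric, but only
their values on the diagonal matter. -/
theorem doubleSeries_apply (a : ℕ × ℕ → ℝ) (k : ℕ) (z : ℝ × ℝ) :
    (doubleSeries a k fun _ => z) =
      ∑ q ∈ Finset.HasAntidiagonal.antidiagonal k, a q * (z.1 ^ q.1 * z.2 ^ q.2) := by
  unfold doubleSeries
  rw [sum_apply]
  refine Finset.sum_congr rfl fun q hq => ?_
  obtain rfl := Finset.HasAntidiagonal.mem_antidiagonal.1 hq
  simp only [smul_apply,
    ContinuousMultilinearMap.compContinuousLinearMap_apply,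
    ContinuousMultilinearMap.mkPiAlgebra_apply, smul_eq_mul]
  rw [Fin.prod_univ_eq_prod_range
    (fun j => (if j < q.1 then ContinuousLinearMap.fst ℝ ℝ ℝ else ContinuousLinearMap.snd ℝ ℝ ℝ) z)
    (q.1 + q.2), Finset.prod_range_add]
  congr 2
  · rw [Finset.prod_congr rfl (g := fun _ => z.1), Finset.prod_const, Finset.card_range]
    intro j hj
    simp [Finset.mem_range.1 hj]
  · simp

theorem radius_doubleSeries {a : ℕ × ℕ → ℝ} {C ρ : ℝ} (hρ : 0 < ρ)
    (h : ∀ p, |a p| ≤ C * ρ ^ (p.1 + p.2)) :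
    ENNReal.ofReal (1 / (2 * ρ)) ≤ (doubleSeries a).radius := by
  have hC : 0 ≤ C := by simpa using (abs_nonneg _).trans (h (0, 0))
  refine FormalMultilinearSeries.le_radius_of_bound _ C fun k => ?_
  have hle : ‖doubleSeries a k‖ ≤ (k + 1) * (C * ρ ^ k) := by
    unfold doubleSeries
    refine (norm_sum_le_of_le (f := fun q => a q • _) (n := fun _ => C * ρ ^ k) _
      fun q hq => ?_).trans ?_
    · rw [norm_smul, Real.norm_eq_abs]
      have h1 := h q
      rw [Finset.HasAntidiagonal.mem_antidiagonal.1 hq] at h1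
      refine (mul_le_of_le_one_right (abs_nonneg _) ?_).trans h1
      refine (ContinuousMultilinearMap.norm_compContinuousLinearMap_le _ _).trans ?_
      rw [ContinuousMultilinearMap.norm_mkPiAlgebra, one_mul]
      refine Finset.prod_le_one (fun _ _ => norm_nonneg _) fun j _ => ?_
      split_ifs
      · exact ContinuousLinearMap.norm_fst_le ℝ ℝ ℝ
      · exact ContinuousLinearMap.norm_snd_le ℝ ℝ ℝ
    · simp
  have hr : ((1 / (2 * ρ)).toNNReal : ℝ) = 1 / (2 * ρ) := Real.coe_toNNReal _ (by positivity)
  rw [hr]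
  -- Degree k has k + 1 monomials; halving the radius absorbs this factor.
  have h2 : ((k : ℝ) + 1) ≤ 2 ^ k := by exact_mod_cast Nat.lt_two_pow_self (n := k)
  calc ‖doubleSeries a k‖ * (1 / (2 * ρ)) ^ k
      ≤ (k + 1) * (C * ρ ^ k) * (1 / (2 * ρ)) ^ k := by gcongr
    _ = C * ((k + 1) / 2 ^ k) := by
      rw [div_pow, mul_pow, one_pow]
      field_simp
    _ ≤ C * 1 := by
      gcongr
      exact (div_le_one (by positivity)).2 h2
    _ = C := mul_one C

/-- The terms divisible by x go into x·b, and the pure powers of y into y·c. This allows Taylor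
coefficients of the sum to be found by induction on the degree, without differentiating the series
termwise. -/
theorem doubleSeries_split {a b c : ℕ × ℕ → ℝ} {A B C ρ : ℝ} (hρ : 0 < ρ)
    (ha : ∀ p, |a p| ≤ A * ρ ^ (p.1 + p.2)) (hb : ∀ p, |b p| ≤ B * ρ ^ (p.1 + p.2))
    (hc : ∀ p, |c p| ≤ C * ρ ^ (p.1 + p.2)) (hab : ∀ m n, a (m + 1, n) = b (m, n))
    (hac : ∀ n, a (0, n + 1) = c (0, n)) (hc0 : ∀ m n, c (m + 1, n) = 0) :
    (doubleSeries a).sum =ᶠ[𝓝 (0, 0)] (fun _ => a (0, 0))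
      + (Prod.fst * (doubleSeries b).sum + Prod.snd * (doubleSeries c).sum) := by
  have hr : 0 < ENNReal.ofReal (1 / (2 * ρ)) := by
    rw [ENNReal.ofReal_pos]; positivity
  filter_upwards [Metric.eball_mem_nhds ((0, 0) : ℝ × ℝ) hr] with z hz
  have s0 := (doubleSeries a).hasSum (Metric.eball_subset_eball (radius_doubleSeries hρ ha) hz)
  have s1 := (doubleSeries b).hasSum (Metric.eball_subset_eball (radius_doubleSeries hρ hb) hz)
  have s2 := (doubleSeries c).hasSum (Metric.eball_subset_eball (radius_doubleSeries hρ hc) hz)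
  rw [← hasSum_nat_add_iff' 1] at s0
  have key : ∀ k, (doubleSeries a (k + 1) fun _ => z) =
      z.1 * (doubleSeries b k fun _ => z) + z.2 * (doubleSeries c k fun _ => z) := by
    intro k
    have hck : (doubleSeries c k fun _ => z) = c (0, k) * z.2 ^ k := by
      rw [doubleSeries_apply, Finset.sum_eq_single (0, k)]
      · simp
      · rintro ⟨i, j⟩ hq hne
        rcases i with - | i
        · have := Finset.HasAntidiagonal.mem_antidiagonal.1 hq
          simp_all
        · simp [hc0]
      · intro hq
        exact absurd (Finset.HasAntidiagonal.mem_antidiagonal.2 (zero_add k)) hq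
    rw [hck, doubleSeries_apply, doubleSeries_apply, Finset.Nat.sum_antidiagonal_succ,
      Finset.mul_sum, hac, add_comm]
    congr 1
    · refine Finset.sum_congr rfl fun q _ => ?_
      rw [hab]
      ring
    · ring
  simp only [key] at s0
  have := s0.unique ((s1.mul_left z.1).add (s2.mul_left z.2))
  simp only [Finset.range_one, Finset.sum_singleton, doubleSeries_apply,
    Finset.Nat.antidiagonal_zero, pow_zero, mul_one] at this
  simp only [Pi.add_apply, Pi.mul_apply]
  linarith

/-- A double sequence of at most geometric growth is the Taylor expansion of an analytic
function. -/
theorem exists_analyticAt_taylor_eq {a : ℕ × ℕ → ℝ} {C ρ : ℝ} (hρ : 0 < ρ)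
    (h : ∀ p, |a p| ≤ C * ρ ^ (p.1 + p.2)) :
    ∃ f : ℝ × ℝ → ℝ, AnalyticAt ℝ f (0, 0) ∧ taylor f = a := by
  have han : ∀ (a : ℕ × ℕ → ℝ) (C : ℝ), (∀ p, |a p| ≤ C * ρ ^ (p.1 + p.2)) →
      AnalyticAt ℝ (doubleSeries a).sum (0, 0) := by
    intro a C h
    have hr : 0 < (doubleSeries a).radius :=
      lt_of_lt_of_le (ENNReal.ofReal_pos.2 (by positivity)) (radius_doubleSeries hρ h)
    exact ((doubleSeries a).hasFPowerSeriesOnBall hr).analyticAt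
  -- The shifted sequences satisfy the bound with C ρ in place of C and the same ρ, so the induction
  -- quantifies over `a` and C.
  have main : ∀ (N : ℕ) (a : ℕ × ℕ → ℝ) (C : ℝ), (∀ p, |a p| ≤ C * ρ ^ (p.1 + p.2)) →
      ∀ m n, m + n = N → taylor (doubleSeries a).sum (m, n) = a (m, n) := by
    intro N
    induction N with
    | zero =>
      intro a C h m n hmn
      obtain ⟨rfl, rfl⟩ : m = 0 ∧ n = 0 := by omega
      have h00 : ((0 : ℝ), (0 : ℝ)) = 0 := rfl
      have hs := (doubleSeries a).hasSum (x := (0, 0)) (Metric.mem_eball_self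
        (lt_of_lt_of_le (ENNReal.ofReal_pos.2 (by positivity)) (radius_doubleSeries hρ h)))
      rw [taylor_zero_zero]
      refine hs.unique ?_
      convert hasSum_single 0 (fun k hk => ?_) using 1
      · simp [doubleSeries_apply]
      · rw [doubleSeries_apply]
        refine Finset.sum_eq_zero fun q hq => ?_
        have := Finset.HasAntidiagonal.mem_antidiagonal.1 hq
        have : q.1 ≠ 0 ∨ q.2 ≠ 0 := by omega
        rcases this with h | h <;> simp [h]
    | succ N ih =>
      intro a C h m n hmn
      have hC : 0 ≤ C := by simpa using (abs_nonneg _).trans (h (0, 0))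
      set b : ℕ × ℕ → ℝ := fun p => a (p.1 + 1, p.2) with hb
      set c : ℕ × ℕ → ℝ := fun p => if p.1 = 0 then a (0, p.2 + 1) else 0 with hc
      have h1 : ∀ p : ℕ × ℕ, |b p| ≤ C * ρ * ρ ^ (p.1 + p.2) := fun p =>
        (h _).trans_eq (by ring)
      have h2 : ∀ p : ℕ × ℕ, |c p| ≤ C * ρ * ρ ^ (p.1 + p.2) := by
        intro p
        simp only [hc]
        split_ifs with hp
        · exact (h _).trans_eq (by rw [hp]; ring)
        · rw [abs_zero]; positivity
      have g1 := han _ _ h1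
      have g2 := han _ _ h2
      rw [taylor_congr (doubleSeries_split hρ h h1 h2 (fun _ _ => rfl) (fun _ => rfl)
        (fun _ _ => rfl)), taylor_add analyticAt_const
        ((analyticAt_fst.mul g1).add (analyticAt_snd.mul g2)),
        taylor_add (analyticAt_fst.mul g1) (analyticAt_snd.mul g2), taylor_const]
      simp only [Pi.add_apply]
      rcases m with - | m
      · obtain rfl : n = N + 1 := by omega
        rw [(taylor_fst_mul g1 0 _).2, (taylor_snd_mul g2 0 N).1, ih c _ h2 0 N (by omega)]
        simp [hc]
      · rw [(taylor_fst_mul g1 m n).1, ih b _ h1 m n (by omega)]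
        rcases n with - | n
        · rw [(taylor_snd_mul g2 (m + 1) 0).2]
          simp [hb]
        · rw [(taylor_snd_mul g2 (m + 1) n).1, ih c _ h2 (m + 1) n (by omega)]
          simp [hb, hc]
  exact ⟨_, han a C h, funext fun p => main _ a C h p.1 p.2 rfl⟩

/-! ### Triple convolutions -/

section convConv

variable {R : Type*} [CommRing R] {a b c a' b' c' : ℕ × ℕ → R} {p : ℕ × ℕ}

theorem conv_conv_congr
    (h : ∀ i j k, i + (j + k) = p → a i * (b j * c k) = a' i * (b' j * c' k)) :
    conv a (conv b c) p = conv a' (conv b' c') p := by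
  unfold conv
  refine Finset.sum_congr rfl fun q hq => ?_
  rw [Finset.mul_sum, Finset.mul_sum]
  refine Finset.sum_congr rfl fun q' hq' => h _ _ _ ?_
  rw [Finset.HasAntidiagonal.mem_antidiagonal.1 hq', Finset.HasAntidiagonal.mem_antidiagonal.1 hq]

theorem conv_conv_mem {S : Type*} [SetLike S R] [AddSubmonoidClass S R] (A : S)
    (h : ∀ i j k, i + (j + k) = p → a i * (b j * c k) ∈ A) :
    conv a (conv b c) p ∈ A := by
  unfold conv
  refine sum_mem fun q hq => ?_
  rw [Finset.mul_sum]
  refine sum_mem fun q' hq' => h _ _ _ ?_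
  rw [Finset.HasAntidiagonal.mem_antidiagonal.1 hq', Finset.HasAntidiagonal.mem_antidiagonal.1 hq]

theorem abs_conv_conv_le {a b c M : ℕ × ℕ → ℝ} {L : ℝ}
    (h : ∀ i j k, i + (j + k) = p → |a i * (b j * c k)| ≤ L * (M i * (M j * M k))) :
    |conv a (conv b c) p| ≤ L * conv M (conv M M) p := by
  unfold conv
  simp only [Finset.mul_sum]
  refine (Finset.abs_sum_le_sum_abs _ _).trans (Finset.sum_le_sum fun q hq => ?_)
  refine (Finset.abs_sum_le_sum_abs _ _).trans (Finset.sum_le_sum fun q' hq' => h _ _ _ ?_)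
  rw [Finset.HasAntidiagonal.mem_antidiagonal.1 hq', Finset.HasAntidiagonal.mem_antidiagonal.1 hq]

theorem map_conv {R' F : Type*} [CommRing R'] [FunLike F R R'] [RingHomClass F R R'] (φ : F)
    (a b : ℕ × ℕ → R) : φ ∘ conv a b = conv (φ ∘ a) (φ ∘ b) := by
  funext p
  simp [conv, map_sum]

/-- The total degree of a pair of exponents. -/
def totalDegree (p : ℕ × ℕ) : ℕ := p.1 + p.2

theorem totalDegree_add (p q : ℕ × ℕ) : totalDegree (p + q) = totalDegree p + totalDegree q := by
  simp only [totalDegree, Prod.fst_add, Prod.snd_add]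
  omega

theorem totalDegree_pos {p : ℕ × ℕ} (hp : p ≠ 0) : 0 < totalDegree p := by
  rw [Ne, Prod.ext_iff] at hp
  simp only [totalDegree, Prod.fst_zero, Prod.snd_zero] at *
  omega

/-- Each factor leaves degree at least 1 to each of the other two. This gap of 2 makes the recursion
well founded and gives the bound l ≤ k - 2. -/
theorem totalDegree_triple {i j k : ℕ × ℕ} (hi : i ≠ 0) (hj : j ≠ 0) (hk : k ≠ 0)
    (h : i + (j + k) = p) : totalDegree i + 2 ≤ totalDegree p ∧
      totalDegree j + 2 ≤ totalDegree p ∧ totalDegree k + 2 ≤ totalDegree p := by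
  have hi := totalDegree_pos hi
  have hj := totalDegree_pos hj
  have hk := totalDegree_pos hk
  rw [← h, totalDegree_add, totalDegree_add]
  omega

theorem conv_conv_congr_of_totalDegree (ha : a 0 = 0) (hb : b 0 = 0) (hc : c 0 = 0)
    (ha' : a' 0 = 0) (hb' : b' 0 = 0) (hc' : c' 0 = 0)
    (h : ∀ q, totalDegree q + 2 ≤ totalDegree p → a q = a' q ∧ b q = b' q ∧ c q = c' q) :
    conv a (conv b c) p = conv a' (conv b' c') p := by
  refine conv_conv_congr fun i j k hijk => ?_
  by_cases hi : i = 0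
  · simp [hi, ha, ha']
  by_cases hj : j = 0
  · simp [hj, hb, hb']
  by_cases hk : k = 0
  · simp [hk, hc, hc']
  obtain ⟨h1, h2, h3⟩ := totalDegree_triple hi hj hk hijk
  rw [(h i h1).1, (h j h2).2.1, (h k h3).2.2]

theorem conv_conv_mem_of_totalDegree {S : Type*} [SetLike S R] [SubringClass S R] (A : S)
    (ha : a 0 = 0) (hb : b 0 = 0) (hc : c 0 = 0)
    (h : ∀ q, totalDegree q + 2 ≤ totalDegree p → a q ∈ A ∧ b q ∈ A ∧ c q ∈ A) :
    conv a (conv b c) p ∈ A := by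
  refine conv_conv_mem A fun i j k hijk => ?_
  by_cases hi : i = 0
  · simp [hi, ha, zero_mem]
  by_cases hj : j = 0
  · simp [hj, hb, zero_mem]
  by_cases hk : k = 0
  · simp [hk, hc, zero_mem]
  obtain ⟨h1, h2, h3⟩ := totalDegree_triple hi hj hk hijk
  exact mul_mem (h i h1).1 (mul_mem (h j h2).2.1 (h k h3).2.2)

end convConv

/-! ### The recursion for the Taylor coefficients -/

/-- The exchange of `a` and `b` in the pure coefficients. -/
def swapData {R : Type*} (d : Fin 4 → ℕ → R) : Fin 4 → ℕ → R := ![d 2, d 3, d 0, d 1]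

theorem swapData_swapData {R : Type*} (d : Fin 4 → ℕ → R) : swapData (swapData d) = d := by
  funext s
  fin_cases s <;> rfl

section recursion

variable {R : Type*} [CommRing R]

/-- The operator `x ∂/∂x` on formal power series. -/
def eulerX (a : ℕ × ℕ → R) (p : ℕ × ℕ) : R := p.1 * a p

/-- The operator `y ∂/∂y` on formal power series. -/
def eulerY (a : ℕ × ℕ → R) (p : ℕ × ℕ) : R := p.2 * a p

/-- The formal power series of
`x y (2 u u_x u_y + v (v_x u_y + v_y u_x) - (u ^ 2 + v ^ 2) u_xy)`. -/
def harmonicCubic (a b : ℕ × ℕ → R) (p : ℕ × ℕ) : R :=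
  2 * conv a (conv (eulerX a) (eulerY a)) p + conv b (conv (eulerX b) (eulerY a)) p
    + conv b (conv (eulerY b) (eulerX a)) p - conv a (conv a (eulerX (eulerY a))) p
    - conv b (conv b (eulerX (eulerY a))) p

/-- The right hand side of the recursion for the Taylor coefficients of `u`, with the pure
coefficients `d 0`, `d 1`. -/
def harmonicStep [Algebra ℝ R] (d : Fin 4 → ℕ → R) (a b : ℕ × ℕ → R) : ℕ × ℕ → R
  | (0, 0) => 0
  | (m + 1, 0) => d 0 (m + 1)
  | (0, n + 1) => d 1 (n + 1)
  | (m + 1, n + 1) => ((m + 1) * (n + 1) : ℝ)⁻¹ • harmonicCubic a b (m + 1, n + 1)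

theorem harmonicCubic_congr {a b a' b' : ℕ × ℕ → R} {p : ℕ × ℕ} (ha : a 0 = 0) (hb : b 0 = 0)
    (ha' : a' 0 = 0) (hb' : b' 0 = 0)
    (h : ∀ q, totalDegree q + 2 ≤ totalDegree p → a q = a' q ∧ b q = b' q) :
    harmonicCubic a b p = harmonicCubic a' b' p := by
  unfold harmonicCubic
  congr 1; congr 1; congr 1; congr 1; congr 1
  all_goals
    refine conv_conv_congr_of_totalDegree ?_ ?_ ?_ ?_ ?_ ?_ fun q hq => ?_ <;>
    simp [eulerX, eulerY, *]

theorem harmonicCubic_mem {S : Type*} [SetLike S R] [SubringClass S R] (A : S)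
    {a b : ℕ × ℕ → R} {p : ℕ × ℕ} (ha : a 0 = 0) (hb : b 0 = 0)
    (h : ∀ q, totalDegree q + 2 ≤ totalDegree p → a q ∈ A ∧ b q ∈ A) :
    harmonicCubic a b p ∈ A := by
  have hX : ∀ (a : ℕ × ℕ → R) q, a q ∈ A → eulerX a q ∈ A := fun a q h =>
    mul_mem (natCast_mem A q.1) h
  have hY : ∀ (a : ℕ × ℕ → R) q, a q ∈ A → eulerY a q ∈ A := fun a q h =>
    mul_mem (natCast_mem A q.2) h
  unfold harmonicCubic
  refine sub_mem (sub_mem (add_mem (add_mem (mul_mem (ofNat_mem A 2) ?_) ?_) ?_) ?_) ?_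
  all_goals
    refine conv_conv_mem_of_totalDegree A ?_ ?_ ?_ fun q hq => ?_
    iterate 3 simp [eulerX, eulerY, *]
    simp only [hX, hY, h q hq, and_self]

theorem map_harmonicCubic {R' F : Type*} [CommRing R'] [FunLike F R R'] [RingHomClass F R R']
    (φ : F) (a b : ℕ × ℕ → R) (p : ℕ × ℕ) :
    φ (harmonicCubic a b p) = harmonicCubic (φ ∘ a) (φ ∘ b) p := by
  have hX : ∀ a : ℕ × ℕ → R, φ ∘ eulerX a = eulerX (φ ∘ a) := fun a => by
    funext q; simp [eulerX]
  have hY : ∀ a : ℕ × ℕ → R, φ ∘ eulerY a = eulerY (φ ∘ a) := fun a => by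
    funext q; simp [eulerY]
  have h : ∀ a b c : ℕ × ℕ → R,
      φ (conv a (conv b c) p) = conv (φ ∘ a) (conv (φ ∘ b) (φ ∘ c)) p := fun a b c => by
    rw [← map_conv, ← map_conv]; rfl
  simp only [harmonicCubic, map_sub, map_add, map_mul, map_ofNat, h, hX, hY]

variable [Algebra ℝ R]

theorem harmonicStep_congr (d : Fin 4 → ℕ → R) {a b a' b' : ℕ × ℕ → R} {p : ℕ × ℕ}
    (ha : a 0 = 0) (hb : b 0 = 0) (ha' : a' 0 = 0) (hb' : b' 0 = 0)
    (h : ∀ q, totalDegree q + 1 ≤ totalDegree p → a q = a' q ∧ b q = b' q) :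
    harmonicStep d a b p = harmonicStep d a' b' p := by
  obtain ⟨_ | m, _ | n⟩ := p
  · rfl
  · rfl
  · rfl
  · simp only [harmonicStep]
    rw [harmonicCubic_congr ha hb ha' hb' fun q hq => h q (by omega)]

theorem map_harmonicStep {R' : Type*} [CommRing R'] [Algebra ℝ R'] (φ : R →ₐ[ℝ] R')
    (d : Fin 4 → ℕ → R) (a b : ℕ × ℕ → R) :
    φ ∘ harmonicStep d a b = harmonicStep (fun s => φ ∘ d s) (φ ∘ a) (φ ∘ b) := by
  funext ⟨m, n⟩
  rcases m with _ | m <;> rcases n with _ | n <;>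
    simp [harmonicStep, map_harmonicCubic]

/-- The iterates of the recursion, starting from zero. -/
def harmonicIter (d : Fin 4 → ℕ → R) : ℕ → ℕ × ℕ → R
  | 0 => 0
  | K + 1 => harmonicStep d (harmonicIter d K) (harmonicIter (swapData d) K)

/-- The solution of the recursion with the pure coefficients `d`. -/
def harmonicSolution (d : Fin 4 → ℕ → R) (p : ℕ × ℕ) : R := harmonicIter d (totalDegree p) p

theorem harmonicIter_zero (d : Fin 4 → ℕ → R) (K : ℕ) : harmonicIter d K 0 = 0 := by
  cases K <;> rfl

/-- A step reads only strictly lower degrees, so the K-th iterate is already final in degrees up to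
K. -/
theorem harmonicIter_eq (K : ℕ) : ∀ (d : Fin 4 → ℕ → R) (L : ℕ), K ≤ L → ∀ p, totalDegree p ≤ K →
    harmonicIter d K p = harmonicIter d L p := by
  induction K with
  | zero =>
    intro d L _ p hp
    obtain rfl : p = 0 := by
      by_contra hne
      exact absurd (totalDegree_pos hne) (by omega)
    rw [harmonicIter_zero, harmonicIter_zero]
  | succ K ih =>
    intro d L hL p hp
    obtain ⟨L, rfl⟩ := Nat.exists_eq_add_of_le' (show 1 ≤ L by omega)
    refine harmonicStep_congr d (harmonicIter_zero _ _) (harmonicIter_zero _ _)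
      (harmonicIter_zero _ _) (harmonicIter_zero _ _) fun q hq => ?_
    exact ⟨ih d L (by omega) q (by omega), ih (swapData d) L (by omega) q (by omega)⟩

theorem harmonicSolution_eq_harmonicIter (d : Fin 4 → ℕ → R) {K : ℕ} {p : ℕ × ℕ}
    (h : totalDegree p ≤ K) : harmonicSolution d p = harmonicIter d K p :=
  harmonicIter_eq _ d K h p le_rfl

theorem harmonicSolution_zero (d : Fin 4 → ℕ → R) : harmonicSolution d 0 = 0 :=
  harmonicIter_zero _ _

theorem harmonicStep_harmonicSolution (d : Fin 4 → ℕ → R) :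
    harmonicStep d (harmonicSolution d) (harmonicSolution (swapData d)) = harmonicSolution d := by
  funext p
  -- One iteration more than needed, so that the right-hand side unfolds to a step.
  rw [harmonicSolution_eq_harmonicIter d (Nat.le_succ (totalDegree p))]
  refine harmonicStep_congr d (harmonicSolution_zero _) (harmonicSolution_zero _)
      (harmonicIter_zero _ _) (harmonicIter_zero _ _) fun q hq => ?_
  exact ⟨harmonicSolution_eq_harmonicIter _ (by omega),
    harmonicSolution_eq_harmonicIter _ (by omega)⟩

theorem eq_harmonicSolution {d : Fin 4 → ℕ → R} {a b : ℕ × ℕ → R}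
    (ha : a = harmonicStep d a b) (hb : b = harmonicStep (swapData d) b a) :
    a = harmonicSolution d ∧ b = harmonicSolution (swapData d) := by
  have ha0 : a 0 = 0 := by rw [ha]; rfl
  have hb0 : b 0 = 0 := by rw [hb]; rfl
  have key : ∀ K p, totalDegree p ≤ K →
      a p = harmonicIter d K p ∧ b p = harmonicIter (swapData d) K p := by
    intro K
    induction K with
    | zero =>
      intro p hp
      obtain rfl : p = 0 := by
        by_contra hne
        exact absurd (totalDegree_pos hne) (by omega)
      rw [harmonicIter_zero, harmonicIter_zero]
      exact ⟨ha0, hb0⟩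
    | succ K ih =>
      intro p hp
      constructor
      · rw [ha]
        exact harmonicStep_congr d ha0 hb0 (harmonicIter_zero _ _) (harmonicIter_zero _ _)
          fun q hq => ih q (by omega)
      · rw [hb, harmonicIter, swapData_swapData]
        exact harmonicStep_congr _ hb0 ha0 (harmonicIter_zero _ _) (harmonicIter_zero _ _)
          fun q hq => (ih q (by omega)).symm
  exact ⟨funext fun p => (key _ p le_rfl).1, funext fun p => (key _ p le_rfl).2⟩

theorem map_harmonicIter {R' : Type*} [CommRing R'] [Algebra ℝ R'] (φ : R →ₐ[ℝ] R') (K : ℕ) :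
    ∀ d : Fin 4 → ℕ → R, φ ∘ harmonicIter d K = harmonicIter (fun s => φ ∘ d s) K := by
  induction K with
  | zero => intro d; funext p; simp [harmonicIter]
  | succ K ih =>
    intro d
    rw [harmonicIter, map_harmonicStep, ih, ih, harmonicIter]
    congr 2
    funext s
    fin_cases s <;> rfl

theorem map_harmonicSolution {R' : Type*} [CommRing R'] [Algebra ℝ R'] (φ : R →ₐ[ℝ] R')
    (d : Fin 4 → ℕ → R) (p : ℕ × ℕ) :
    φ (harmonicSolution d p) = harmonicSolution (fun s => φ ∘ d s) p :=
  congrFun (map_harmonicIter φ _ d) p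

/-- In degree 2 the cubic sees only the constant terms, which are zero. This is why the mixed terms
start in degree 3. -/
theorem harmonicSolution_one_one (d : Fin 4 → ℕ → R) : harmonicSolution d (1, 1) = 0 := by
  have h : harmonicCubic (harmonicSolution d) (harmonicSolution (swapData d)) (1, 1)
      = harmonicCubic (0 : ℕ × ℕ → R) 0 (1, 1) := by
    refine harmonicCubic_congr (harmonicSolution_zero _) (harmonicSolution_zero _) rfl rfl
      fun q hq => ?_
    obtain rfl : q = 0 := by
      by_contra hne
      have := totalDegree_pos hne
      have : totalDegree (1, 1) = 2 := rfl
      omega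
    exact ⟨harmonicSolution_zero _, harmonicSolution_zero _⟩
  rw [← harmonicStep_harmonicSolution]
  simp only [harmonicStep, h]
  simp [harmonicCubic, conv]

end recursion

/-- The pure coefficients, as indeterminates. -/
def universalData (s : Fin 4) (l : ℕ) : MvPolynomial (Fin 4 × ℕ) ℝ := MvPolynomial.X (s, l)

/-- The weak bound, valid for all exponents, feeds the sharp one: a mixed coefficient reads only
coefficients whose degree is smaller by at least 2. General `d` is needed because the induction also
passes to `swapData d`. -/
theorem harmonicSolution_mem_supported (K : ℕ) : ∀ (d : Fin 4 → ℕ → MvPolynomial (Fin 4 × ℕ) ℝ),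
    (∀ s l, d s l ∈ MvPolynomial.supported ℝ {q : Fin 4 × ℕ | q.2 = l}) → ∀ p, totalDegree p ≤ K →
    harmonicSolution d p ∈
      MvPolynomial.supported ℝ {q : Fin 4 × ℕ | 1 ≤ q.2 ∧ q.2 ≤ totalDegree p} ∧
    (p.1 ≠ 0 → p.2 ≠ 0 → harmonicSolution d p ∈
      MvPolynomial.supported ℝ {q : Fin 4 × ℕ | 1 ≤ q.2 ∧ q.2 + 2 ≤ totalDegree p}) := by
  induction K with
  | zero =>
    intro d _ p hp
    obtain rfl : p = 0 := by
      by_contra hne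
      exact absurd (totalDegree_pos hne) (by omega)
    rw [harmonicSolution_zero]
    exact ⟨zero_mem _, fun h => absurd rfl h⟩
  | succ K ih =>
    intro d hd p hp
    have hd' : ∀ s l, swapData d s l ∈ MvPolynomial.supported ℝ {q : Fin 4 × ℕ | q.2 = l} := by
      intro s l
      fin_cases s <;> exact hd _ l
    have hmono : ∀ {s t : Set (Fin 4 × ℕ)}, s ⊆ t →
        MvPolynomial.supported ℝ s ≤ MvPolynomial.supported ℝ t :=
      fun h => MvPolynomial.supported_mono h
    have hmix : p.1 ≠ 0 → p.2 ≠ 0 → harmonicSolution d p ∈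
        MvPolynomial.supported ℝ {q : Fin 4 × ℕ | 1 ≤ q.2 ∧ q.2 + 2 ≤ totalDegree p} := by
      intro h1 h2
      obtain ⟨_ | m, _ | n⟩ := p
      · exact absurd rfl h1
      · exact absurd rfl h1
      · exact absurd rfl h2
      · rw [← harmonicStep_harmonicSolution]
        simp only [harmonicStep]
        refine Subalgebra.smul_mem _ (harmonicCubic_mem _ (harmonicSolution_zero _)
          (harmonicSolution_zero _) fun q hq => ?_) _
        have hsub : {r : Fin 4 × ℕ | 1 ≤ r.2 ∧ r.2 ≤ totalDegree q} ⊆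
            {r : Fin 4 × ℕ | 1 ≤ r.2 ∧ r.2 + 2 ≤ totalDegree (m + 1, n + 1)} :=
          fun r hr => ⟨hr.1, by have := hr.2; omega⟩
        exact ⟨hmono hsub (ih d hd q (by omega)).1, hmono hsub (ih _ hd' q (by omega)).1⟩
    refine ⟨?_, hmix⟩
    by_cases h1 : p.1 ≠ 0 ∧ p.2 ≠ 0
    · refine hmono ?_ (hmix h1.1 h1.2)
      exact fun r hr => ⟨hr.1, by have := hr.2; omega⟩
    · rw [← harmonicStep_harmonicSolution]
      obtain ⟨_ | m, _ | n⟩ := p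
      · exact zero_mem _
      · refine hmono ?_ (hd 1 (n + 1))
        rintro r (hr : r.2 = n + 1)
        exact ⟨by omega, by simp only [totalDegree]; omega⟩
      · refine hmono ?_ (hd 0 (m + 1))
        rintro r (hr : r.2 = m + 1)
        exact ⟨by omega, by simp only [totalDegree]; omega⟩
      · simp at h1

theorem vars_harmonicSolution_universalData {p q} (h1 : p.1 ≠ 0) (h2 : p.2 ≠ 0)
    (hq : q ∈ (harmonicSolution universalData p).vars) : 1 ≤ q.2 ∧ q.2 + 2 ≤ totalDegree p := by
  have := (harmonicSolution_mem_supported _ universalData (fun s l => ?_) p le_rfl).2 h1 h2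
  · exact MvPolynomial.mem_supported.1 this hq
  · exact MvPolynomial.mem_supported.2 (by simp [universalData])

/-! ### Growth of the solution of the recursion -/

/-- In each product x∂x and y∂y act once, on factors whose exponents are at most those of p, so the
weights contribute at most p.1 · p.2. The constant is 6 = 2 + 1 + 1 + 1 + 1. -/
theorem abs_harmonicCubic_le {a b : ℕ × ℕ → ℝ} (p : ℕ × ℕ) :
    |harmonicCubic a b p| ≤ p.1 * p.2 * 6 *
      conv (fun q => |a q| + |b q|)
        (conv (fun q => |a q| + |b q|) fun q => |a q| + |b q|) p := by
  have main : ∀ (s t r : ℕ × ℕ → ℝ), (∀ q, |s q| ≤ |a q| + |b q|) →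
      (∀ i j k : ℕ × ℕ, i + (j + k) = p →
        |t j * r k| ≤ p.1 * p.2 * ((|a j| + |b j|) * (|a k| + |b k|))) →
      |conv s (conv t r) p| ≤ p.1 * p.2 * conv (fun q => |a q| + |b q|)
        (conv (fun q => |a q| + |b q|) fun q => |a q| + |b q|) p := by
    intro s t r hs htr
    refine abs_conv_conv_le fun i j k hijk => ?_
    rw [abs_mul]
    calc |s i| * |t j * r k|
        ≤ (|a i| + |b i|) * (p.1 * p.2 * ((|a j| + |b j|) * (|a k| + |b k|))) := by
          gcongr
          · exact hs i
          · exact htr i j k hijk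
      _ = _ := by ring
  have ha : ∀ q, |a q| ≤ |a q| + |b q| := fun q => le_add_of_nonneg_right (abs_nonneg _)
  have hb : ∀ q, |b q| ≤ |a q| + |b q| := fun q => le_add_of_nonneg_left (abs_nonneg _)
  have prod : ∀ {x y : ℝ} {m n : ℕ} {j k : ℕ × ℕ}, m ≤ p.1 → n ≤ p.2 → |x| ≤ |a j| + |b j| →
      |y| ≤ |a k| + |b k| →
      (m : ℝ) * n * (|x| * |y|) ≤ p.1 * p.2 * ((|a j| + |b j|) * (|a k| + |b k|)) := by
    intro x y m n j k hm hn hx hy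
    gcongr
  have le1 : ∀ {i j k : ℕ × ℕ}, i + (j + k) = p → j.1 ≤ p.1 ∧ j.2 ≤ p.2 ∧ k.1 ≤ p.1 ∧ k.2 ≤ p.2 := by
    rintro i j k rfl
    simp only [Prod.fst_add, Prod.snd_add]
    omega
  have t1 := main a (eulerX a) (eulerY a) ha fun i j k h => by
    refine le_of_eq_of_le ?_ (prod (le1 h).1 (le1 h).2.2.2 (ha j) (ha k))
    simp only [eulerX, eulerY, abs_mul, Nat.abs_cast]
    ring
  have t2 := main b (eulerX b) (eulerY a) hb fun i j k h => by
    refine le_of_eq_of_le ?_ (prod (le1 h).1 (le1 h).2.2.2 (hb j) (ha k))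
    simp only [eulerX, eulerY, abs_mul, Nat.abs_cast]
    ring
  have t3 := main b (eulerY b) (eulerX a) hb fun i j k h => by
    refine le_of_eq_of_le ?_ (prod (le1 h).2.2.1 (le1 h).2.1 (hb j) (ha k))
    simp only [eulerX, eulerY, abs_mul, Nat.abs_cast]
    ring
  have t4 := main a a (eulerX (eulerY a)) ha fun i j k h => by
    refine le_of_eq_of_le ?_ (prod (le1 h).2.2.1 (le1 h).2.2.2 (ha j) (ha k))
    simp only [eulerX, eulerY, abs_mul, Nat.abs_cast]
    ring
  have t5 := main b b (eulerX (eulerY a)) hb fun i j k h => by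
    refine le_of_eq_of_le ?_ (prod (le1 h).2.2.1 (le1 h).2.2.2 (hb j) (ha k))
    simp only [eulerX, eulerY, abs_mul, Nat.abs_cast]
    ring
  rw [abs_le] at t1 t2 t3 t4 t5 ⊢
  unfold harmonicCubic
  constructor <;> linarith [t1.1, t1.2, t2.1, t2.2, t3.1, t3.2, t4.1, t4.2, t5.1, t5.2]

/-- The sum of the absolute values of the pure coefficients, as a double sequence. -/
def pureBound (d : Fin 4 → ℕ → ℝ) (p : ℕ × ℕ) : ℝ :=
  if p ≠ 0 ∧ (p.1 = 0 ∨ p.2 = 0) then ∑ s, |d s (totalDegree p)| else 0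

theorem pureBound_nonneg (d : Fin 4 → ℕ → ℝ) (p : ℕ × ℕ) : 0 ≤ pureBound d p := by
  unfold pureBound
  split_ifs
  · exact Finset.sum_nonneg fun _ _ => abs_nonneg _
  · exact le_rfl

/-- The division in the recursion cancels the Euler weights exactly, leaving a derivative-free cubic
inequality for |a| + |b|. The constant 12 counts 6 for each of the two equations. -/
theorem abs_harmonicStep_add_le (d : Fin 4 → ℕ → ℝ) (a b : ℕ × ℕ → ℝ) (p : ℕ × ℕ) :
    |harmonicStep d a b p| + |harmonicStep (swapData d) b a p| ≤ pureBound d p + 12 *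
      conv (fun q => |a q| + |b q|)
        (conv (fun q => |a q| + |b q|) fun q => |a q| + |b q|) p := by
  have hconv : 0 ≤ conv (fun q => |a q| + |b q|)
      (conv (fun q => |a q| + |b q|) fun q => |a q| + |b q|) p := by
    unfold conv
    positivity
  obtain ⟨_ | m, _ | n⟩ := p
  · simp only [harmonicStep, abs_zero]
    have := pureBound_nonneg d (0, 0)
    linarith
  · have : pureBound d (0, n + 1) = |d 0 (n + 1)| + |d 1 (n + 1)| + |d 2 (n + 1)| + |d 3 (n + 1)| := by
      simp [pureBound, totalDegree, Fin.sum_univ_four, Prod.ext_iff]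
    rw [this]
    simp only [harmonicStep, swapData, Matrix.cons_val_one, Matrix.cons_val_zero]
    linarith [abs_nonneg (d 0 (n + 1)), abs_nonneg (d 2 (n + 1))]
  · have : pureBound d (m + 1, 0) = |d 0 (m + 1)| + |d 1 (m + 1)| + |d 2 (m + 1)| + |d 3 (m + 1)| := by
      simp [pureBound, totalDegree, Fin.sum_univ_four, Prod.ext_iff]
    rw [this]
    simp only [harmonicStep, swapData, Matrix.cons_val_zero]
    linarith [abs_nonneg (d 1 (m + 1)), abs_nonneg (d 3 (m + 1))]
  · have h0 : (0 : ℝ) < (m + 1) * (n + 1) := by positivity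
    have step : ∀ a b : ℕ × ℕ → ℝ, ∀ d, |harmonicStep d a b (m + 1, n + 1)| ≤
        6 * conv (fun q => |a q| + |b q|)
          (conv (fun q => |a q| + |b q|) fun q => |a q| + |b q|) (m + 1, n + 1) := by
      intro a b d
      have := abs_harmonicCubic_le (a := a) (b := b) (m + 1, n + 1)
      push_cast at this
      simp only [harmonicStep, smul_eq_mul]
      rw [abs_mul, abs_inv, abs_of_pos h0, inv_mul_le_iff₀ h0]
      linarith
    have h1 := step a b d
    have h2 := step b a (swapData d)
    simp only [add_comm |b _|] at h2
    have := pureBound_nonneg d (m + 1, n + 1)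
    linarith

theorem ENNReal.tsum_conv (f g : ℕ × ℕ → ENNReal) : ∑' p, conv f g p = (∑' p, f p) * ∑' p, g p := by
  rw [← ENNReal.tsum_mul_right]
  simp only [← ENNReal.tsum_mul_left]
  rw [← ENNReal.tsum_prod (f := fun p q => f p * g q),
    ← Finset.HasAntidiagonal.sigmaAntidiagonalEquivProd.tsum_eq
      fun z : (ℕ × ℕ) × (ℕ × ℕ) => f z.1 * g z.2, ENNReal.tsum_sigma']
  refine tsum_congr fun p => ?_
  exact (Finset.tsum_subtype (Finset.HasAntidiagonal.antidiagonal p)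
    fun q => f q.1 * g q.2).symm

/-- The weighted sum `∑ M (i, j) r ^ (i + j)` of a nonnegative double sequence. -/
def weightedSum (r : ℝ) (M : ℕ × ℕ → ℝ) : ENNReal :=
  ∑' p, ENNReal.ofReal (M p * r ^ totalDegree p)

theorem weightedSum_mono {r : ℝ} (hr : 0 ≤ r) {M M' : ℕ × ℕ → ℝ} (h : ∀ p, M p ≤ M' p) :
    weightedSum r M ≤ weightedSum r M' :=
  ENNReal.tsum_le_tsum fun p => ENNReal.ofReal_le_ofReal
    (mul_le_mul_of_nonneg_right (h p) (by positivity))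

theorem weightedSum_add {r : ℝ} (hr : 0 ≤ r) {M M' : ℕ × ℕ → ℝ} (h : ∀ p, 0 ≤ M p)
    (h' : ∀ p, 0 ≤ M' p) : weightedSum r (M + M') = weightedSum r M + weightedSum r M' := by
  unfold weightedSum
  rw [← ENNReal.tsum_add]
  refine tsum_congr fun p => ?_
  rw [← ENNReal.ofReal_add (mul_nonneg (h p) (by positivity)) (mul_nonneg (h' p) (by positivity)),
    Pi.add_apply, add_mul]

theorem weightedSum_const_mul (r : ℝ) {c : ℝ} (hc : 0 ≤ c) (M : ℕ × ℕ → ℝ) :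
    weightedSum r (fun p => c * M p) = ENNReal.ofReal c * weightedSum r M := by
  unfold weightedSum
  rw [← ENNReal.tsum_mul_left]
  refine tsum_congr fun p => ?_
  rw [← ENNReal.ofReal_mul hc, mul_assoc]

theorem weightedSum_conv {r : ℝ} (hr : 0 ≤ r) {M M' : ℕ × ℕ → ℝ} (h : ∀ p, 0 ≤ M p)
    (h' : ∀ p, 0 ≤ M' p) : weightedSum r (conv M M') = weightedSum r M * weightedSum r M' := by
  unfold weightedSum
  rw [← ENNReal.tsum_conv]
  refine tsum_congr fun p => ?_
  have h1 : ∀ q, 0 ≤ M q * r ^ totalDegree q := fun q => mul_nonneg (h q) (by positivity)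
  have h2 : ∀ q, 0 ≤ M' q * r ^ totalDegree q := fun q => mul_nonneg (h' q) (by positivity)
  unfold conv
  rw [Finset.sum_mul, ENNReal.ofReal_sum_of_nonneg]
  · refine Finset.sum_congr rfl fun q hq => ?_
    rw [← ENNReal.ofReal_mul (h1 _), ← Finset.HasAntidiagonal.mem_antidiagonal.1 hq,
      totalDegree_add, pow_add]
    congr 1
    ring
  · exact fun q _ => mul_nonneg (mul_nonneg (h _) (h' _)) (by positivity)

/-- The map S ↦ 1/12 + 12 S³ sends [0, 1/6] into itself, since 1/12 + 12/216 = 5/36 < 1/6. -/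
theorem exists_weightedSum_harmonicIter_le {d : Fin 4 → ℕ → ℝ} {n : ℕ}
    (hd : ∀ s l, n < l → d s l = 0) :
    ∃ r : ℝ, 0 < r ∧ ∀ K, weightedSum r
      (fun p => |harmonicIter d K p| + |harmonicIter (swapData d) K p|)
        ≤ ENNReal.ofReal (1 / 6) := by
  set B := Finset.range (n + 1) ×ˢ Finset.range (n + 1) with hB
  set L := ∑ p ∈ B, pureBound d p with hL
  have hL0 : 0 ≤ L := Finset.sum_nonneg fun p _ => pureBound_nonneg d p
  -- Pure terms have degree at least 1 and r ≤ 1, so their weighted sum is at most L r ≤ 1/12.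
  set r : ℝ := 1 / (12 * (L + 1)) with hrdef
  have hr : 0 < r := by positivity
  have hr1 : r ≤ 1 := by
    rw [hrdef, div_le_one (by positivity)]
    linarith
  have hpure : weightedSum r (pureBound d) ≤ ENNReal.ofReal (1 / 12) := by
    have h0 : ∀ p ∉ B, ENNReal.ofReal (pureBound d p * r ^ totalDegree p) = 0 := by
      intro p hp
      have : pureBound d p = 0 := by
        unfold pureBound
        split_ifs
        · have hdeg : n < totalDegree p := by
            simp only [hB, Finset.mem_product, Finset.mem_range] at hp
            simp only [totalDegree]
            omega
          simp [hd _ _ hdeg]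
        · rfl
      simp [this]
    unfold weightedSum
    rw [tsum_eq_sum h0, ← ENNReal.ofReal_sum_of_nonneg fun p _ =>
      mul_nonneg (pureBound_nonneg d p) (by positivity)]
    refine ENNReal.ofReal_le_ofReal ?_
    calc ∑ p ∈ B, pureBound d p * r ^ totalDegree p ≤ ∑ p ∈ B, pureBound d p * r := by
          refine Finset.sum_le_sum fun p _ => ?_
          by_cases hp : p = 0
          · simp [hp, pureBound]
          · exact mul_le_mul_of_nonneg_left
              (pow_le_of_le_one hr.le hr1 (totalDegree_pos hp).ne') (pureBound_nonneg d p)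
      _ = L * r := by rw [← Finset.sum_mul]
      _ ≤ 1 / 12 := by
        rw [hrdef, mul_one_div, div_le_div_iff₀ (by positivity) (by norm_num)]
        linarith
  refine ⟨r, hr, fun K => ?_⟩
  induction K with
  | zero => simp [weightedSum, harmonicIter]
  | succ K ih =>
    set M : ℕ × ℕ → ℝ := fun p => |harmonicIter d K p| + |harmonicIter (swapData d) K p| with hM
    have hM0 : ∀ p, 0 ≤ M p := fun p => by positivity
    have hMM0 : ∀ p, 0 ≤ conv M M p := fun p =>
      Finset.sum_nonneg fun q _ => mul_nonneg (hM0 _) (hM0 _)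
    have hMMM0 : ∀ p, 0 ≤ 12 * conv M (conv M M) p := fun p =>
      mul_nonneg (by norm_num) (Finset.sum_nonneg fun q _ => mul_nonneg (hM0 _) (hMM0 _))
    have hstep := weightedSum_mono hr.le (M := fun p =>
        |harmonicIter d (K + 1) p| + |harmonicIter (swapData d) (K + 1) p|)
      (M' := pureBound d + fun p => 12 * conv M (conv M M) p) fun p => by
        have := abs_harmonicStep_add_le d (harmonicIter d K) (harmonicIter (swapData d) K) p
        simpa only [harmonicIter, swapData_swapData, Pi.add_apply, hM] using this
    rw [weightedSum_add hr.le (pureBound_nonneg d) hMMM0, weightedSum_const_mul r (by norm_num),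
      weightedSum_conv hr.le hM0 hMM0, weightedSum_conv hr.le hM0 hM0] at hstep
    refine hstep.trans ?_
    calc _ ≤ ENNReal.ofReal (1 / 12) + ENNReal.ofReal 12 *
          (ENNReal.ofReal (1 / 6) * (ENNReal.ofReal (1 / 6) * ENNReal.ofReal (1 / 6))) := by
          gcongr
      _ = ENNReal.ofReal (1 / 12 + 12 * (1 / 6 * (1 / 6 * (1 / 6)))) := by
        rw [← ENNReal.ofReal_mul (by norm_num), ← ENNReal.ofReal_mul (by norm_num),
          ← ENNReal.ofReal_mul (by norm_num), ← ENNReal.ofReal_add (by norm_num) (by norm_num)]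
      _ ≤ ENNReal.ofReal (1 / 6) := ENNReal.ofReal_le_ofReal (by norm_num)

/-- A single term is bounded by the whole weighted sum, so ρ = 1/r works. -/
theorem exists_abs_harmonicSolution_le {d : Fin 4 → ℕ → ℝ} {n : ℕ}
    (hd : ∀ s l, n < l → d s l = 0) :
    ∃ ρ : ℝ, 0 < ρ ∧ ∀ p : ℕ × ℕ, |harmonicSolution d p| ≤ 1 * ρ ^ (p.1 + p.2) := by
  obtain ⟨r, hr, h⟩ := exists_weightedSum_harmonicIter_le hd
  refine ⟨r⁻¹, inv_pos.2 hr, fun p => ?_⟩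
  have h1 := (ENNReal.le_tsum p).trans (h (totalDegree p))
  rw [ENNReal.ofReal_le_ofReal_iff (by norm_num)] at h1
  have h2 : |harmonicSolution d p| * r ^ totalDegree p ≤ 1 / 6 := by
    refine le_trans ?_ h1
    gcongr
    exact le_add_of_nonneg_right (abs_nonneg _)
  rw [one_mul, inv_pow, ← one_div, le_div_iff₀ (by positivity)]
  exact h2.trans (by norm_num)

/-! ### The harmonic map equation in affine coordinates -/

/-- The function `(1 + u ^ 2 + v ^ 2) u_xy - 2 u u_x u_y - v (v_x u_y + v_y u_x)`. -/
def harmonicDefect (u v : ℝ × ℝ → ℝ) (p : ℝ × ℝ) : ℝ :=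
  (1 + u p ^ 2 + v p ^ 2) * partialY (partialX u) p - 2 * (u p * (partialX u p * partialY u p))
    - v p * (partialX v p * partialY u p + partialY v p * partialX u p)

section analyticEquation

variable {u v : ℝ × ℝ → ℝ}

theorem AnalyticAt.harmonicDefect {p : ℝ × ℝ} (hu : AnalyticAt ℝ u p) (hv : AnalyticAt ℝ v p) :
    AnalyticAt ℝ (harmonicDefect u v) p :=
  ((((analyticAt_const.add (hu.pow 2)).add (hv.pow 2)).mul hu.partialX.partialY).sub
    (analyticAt_const.mul (hu.mul (hu.partialX.mul hu.partialY)))).sub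
    (hv.mul ((hv.partialX.mul hu.partialY).add (hv.partialY.mul hu.partialX)))

theorem taylor_fst_mul_partialX (hu : AnalyticAt ℝ u (0, 0)) :
    taylor (Prod.fst * partialX u) = eulerX (taylor u) := by
  funext ⟨m, n⟩
  cases m with
  | zero => simp [(taylor_fst_mul hu.partialX 0 n).2, eulerX]
  | succ m => simp [(taylor_fst_mul hu.partialX m n).1, eulerX, taylor_partialX hu]

theorem taylor_snd_mul_partialY (hu : AnalyticAt ℝ u (0, 0)) :
    taylor (Prod.snd * partialY u) = eulerY (taylor u) := by
  funext ⟨m, n⟩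
  cases n with
  | zero => simp [(taylor_snd_mul hu.partialY m 0).2, eulerY]
  | succ n => simp [(taylor_snd_mul hu.partialY m n).1, eulerY, taylor_partialY]

theorem taylor_fst_mul_snd_mul_partialY_partialX (hu : AnalyticAt ℝ u (0, 0)) :
    taylor (Prod.fst * (Prod.snd * partialY (partialX u))) = eulerX (eulerY (taylor u)) := by
  have h := analyticAt_snd.mul hu.partialX.partialY
  funext ⟨m, n⟩
  cases m with
  | zero => simp [(taylor_fst_mul h 0 n).2, eulerX]
  | succ m =>
    rw [(taylor_fst_mul h m n).1, taylor_snd_mul_partialY hu.partialX]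
    simp [eulerX, eulerY, taylor_partialX hu]
    ring

/-- The factor xy pairs each derivative with its variable, so no exponent is shifted. -/
theorem taylor_fst_mul_snd_mul_harmonicDefect (hu : AnalyticAt ℝ u (0, 0))
    (hv : AnalyticAt ℝ v (0, 0)) (p : ℕ × ℕ) :
    taylor (Prod.fst * (Prod.snd * harmonicDefect u v)) p =
      p.1 * p.2 * taylor u p - harmonicCubic (taylor u) (taylor v) p := by
  have hx : AnalyticAt ℝ (Prod.fst : ℝ × ℝ → ℝ) (0, 0) := analyticAt_fst
  have hy : AnalyticAt ℝ (Prod.snd : ℝ × ℝ → ℝ) (0, 0) := analyticAt_snd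
  have ux := hx.mul hu.partialX
  have uy := hy.mul hu.partialY
  have vx := hx.mul hv.partialX
  have vy := hy.mul hv.partialY
  have uxy := hx.mul (hy.mul hu.partialX.partialY)
  set UX := Prod.fst * partialX u
  set UY := Prod.snd * partialY u
  set VX := Prod.fst * partialX v
  set VY := Prod.snd * partialY v
  set UXY := Prod.fst * (Prod.snd * partialY (partialX u))
  -- Negative terms are moved across and the factor 2 is written as a repeated summand, so that
  -- additivity and multiplicativity of `taylor` suffice.
  have h1 : Prod.fst * (Prod.snd * harmonicDefect u v) + (u * (UX * UY) + (u * (UX * UY)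
      + (v * (VX * UY) + v * (VY * UX)))) = UXY + (u * (u * UXY) + v * (v * UXY)) := by
    funext q
    simp only [harmonicDefect, Pi.add_apply, Pi.mul_apply, UX, UY, VX, VY, UXY]
    ring
  have t1 := hu.mul (ux.mul uy)
  have t2 := hv.mul (vx.mul uy)
  have t3 := hv.mul (vy.mul ux)
  have t4 := hu.mul (hu.mul uxy)
  have t5 := hv.mul (hv.mul uxy)
  have h2 := congrFun (congrArg taylor h1) p
  rw [taylor_add (hx.mul (hy.mul (hu.harmonicDefect hv))) (t1.add (t1.add (t2.add t3))),
    taylor_add t1 (t1.add (t2.add t3)), taylor_add t1 (t2.add t3), taylor_add t2 t3,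
    taylor_add uxy (t4.add t5), taylor_add t4 t5, taylor_mul hu (ux.mul uy), taylor_mul ux uy,
    taylor_mul hv (vx.mul uy), taylor_mul vx uy, taylor_mul hv (vy.mul ux), taylor_mul vy ux,
    taylor_mul hu (hu.mul uxy), taylor_mul hu uxy, taylor_mul hv (hv.mul uxy), taylor_mul hv uxy,
    taylor_fst_mul_partialX hu, taylor_fst_mul_partialX hv, taylor_snd_mul_partialY hu,
    taylor_snd_mul_partialY hv, taylor_fst_mul_snd_mul_partialY_partialX hu] at h2
  simp only [Pi.add_apply] at h2
  have h3 : eulerX (eulerY (taylor u)) p = p.1 * p.2 * taylor u p := by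
    simp only [eulerX, eulerY]
    ring
  rw [h3] at h2
  unfold harmonicCubic
  linarith

theorem taylor_eq_harmonicStep (hu : AnalyticAt ℝ u (0, 0)) (hv : AnalyticAt ℝ v (0, 0))
    (h0 : u (0, 0) = 0) (h : ∀ᶠ p in 𝓝 (0, 0), harmonicDefect u v p = 0) {d : Fin 4 → ℕ → ℝ}
    (hd0 : ∀ m, d 0 (m + 1) = taylor u (m + 1, 0)) (hd1 : ∀ n, d 1 (n + 1) = taylor u (0, n + 1)) :
    taylor u = harmonicStep d (taylor u) (taylor v) := by
  funext ⟨m, n⟩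
  rcases m with _ | m <;> rcases n with _ | n
  · simp [harmonicStep, taylor_zero_zero, h0]
  · exact (hd1 n).symm
  · exact (hd0 m).symm
  · have h1 := taylor_fst_mul_snd_mul_harmonicDefect hu hv (m + 1, n + 1)
    have hE := hu.harmonicDefect hv
    rw [(taylor_fst_mul (analyticAt_snd.mul hE) m (n + 1)).1, (taylor_snd_mul hE m n).1,
      taylor_congr (g := fun _ => 0) h, taylor_const] at h1
    simp only [harmonicStep, smul_eq_mul]
    rw [eq_inv_mul_iff_mul_eq₀ (by positivity)]
    push_cast at h1
    simp only [ite_self] at h1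
    linarith

theorem harmonicDefect_eventually_eq_zero (hu : AnalyticAt ℝ u (0, 0))
    (hv : AnalyticAt ℝ v (0, 0)) {d : Fin 4 → ℕ → ℝ}
    (h : taylor u = harmonicStep d (taylor u) (taylor v)) :
    ∀ᶠ p in 𝓝 (0, 0), harmonicDefect u v p = 0 := by
  have hE := hu.harmonicDefect hv
  refine eventually_eq_zero_of_taylor_eq_zero hE ?_
  funext ⟨m, n⟩
  -- The coefficient of the defect at (m, n) is that of xy times the defect at (m + 1, n + 1), so
  -- the mixed equations control all of its coefficients.
  have h1 := taylor_fst_mul_snd_mul_harmonicDefect hu hv (m + 1, n + 1)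
  rw [(taylor_fst_mul (analyticAt_snd.mul hE) m (n + 1)).1, (taylor_snd_mul hE m n).1] at h1
  have h2 := congrFun h (m + 1, n + 1)
  simp only [harmonicStep, smul_eq_mul] at h2
  rw [eq_inv_mul_iff_mul_eq₀ (by positivity)] at h2
  push_cast at h1
  rw [h1, ← h2]
  simp

end analyticEquation

/-! ### The harmonic map equation on the sphere -/

section sphere

theorem partialX_euclidean_apply {N : ℝ × ℝ → EuclideanSpace ℝ (Fin 3)} {p : ℝ × ℝ}
    (hN : AnalyticAt ℝ N p) (i : Fin 3) : partialX N p i = partialX (fun q => N q i) p := by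
  have := ((EuclideanSpace.proj (𝕜 := ℝ) i).hasFDerivAt.comp p
    hN.differentiableAt.hasFDerivAt).fderiv
  exact (congrArg (fun L : ℝ × ℝ →L[ℝ] ℝ => L (1, 0)) this).symm

theorem partialY_euclidean_apply {N : ℝ × ℝ → EuclideanSpace ℝ (Fin 3)} {p : ℝ × ℝ}
    (hN : AnalyticAt ℝ N p) (i : Fin 3) : partialY N p i = partialY (fun q => N q i) p := by
  have := ((EuclideanSpace.proj (𝕜 := ℝ) i).hasFDerivAt.comp p
    hN.differentiableAt.hasFDerivAt).fderiv
  exact (congrArg (fun L : ℝ × ℝ →L[ℝ] ℝ => L (0, 1)) this).symm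

theorem AnalyticAt.euclidean_apply {N : ℝ × ℝ → EuclideanSpace ℝ (Fin 3)} {p : ℝ × ℝ}
    (hN : AnalyticAt ℝ N p) (i : Fin 3) : AnalyticAt ℝ (fun q => N q i) p :=
  ((EuclideanSpace.proj (𝕜 := ℝ) i).analyticAt _).comp hN

theorem partialY_partialX_euclidean_apply {N : ℝ × ℝ → EuclideanSpace ℝ (Fin 3)} {p : ℝ × ℝ}
    (hN : AnalyticAt ℝ N p) (i : Fin 3) :
    partialY (partialX N) p i = partialY (partialX fun q => N q i) p := by
  rw [partialY_euclidean_apply hN.partialX]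
  have : (fun q => partialX N q i) =ᶠ[𝓝 p] partialX fun q => N q i :=
    hN.eventually_analyticAt.mono fun q hq => partialX_euclidean_apply hq i
  exact this.partialY.eq_of_nhds

theorem partialY_partialX_mul {f g : ℝ × ℝ → ℝ} {p : ℝ × ℝ} (hf : AnalyticAt ℝ f p)
    (hg : AnalyticAt ℝ g p) : partialY (partialX (f * g)) p =
      partialY (partialX f) p * g p + partialX f p * partialY g p + partialY f p * partialX g p
        + f p * partialY (partialX g) p := by
  have h : partialX (f * g) =ᶠ[𝓝 p] partialX f * g + f * partialX g := by
    filter_upwards [hf.eventually_analyticAt, hg.eventually_analyticAt] with q h1 h2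
    exact partialX_mul h1 h2
  rw [h.partialY.eq_of_nhds, partialY_add (hf.partialX.mul hg) (hf.mul hg.partialX),
    partialY_mul hf.partialX hg, partialY_mul hf hg.partialX]
  ring

/-- Differentiate c² (1 + u² + v²) = 1 and cancel 2c, which is nonzero by the same identity. -/
theorem mul_partial_of_scale {u v c : ℝ × ℝ → ℝ} {p : ℝ × ℝ} (hu : AnalyticAt ℝ u p)
    (hv : AnalyticAt ℝ v p) (hc : AnalyticAt ℝ c p)
    (h : ∀ᶠ q in 𝓝 p, c q ^ 2 * (1 + u q ^ 2 + v q ^ 2) = 1) :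
    (1 + u p ^ 2 + v p ^ 2) * partialX c p = - c p * (u p * partialX u p + v p * partialX v p) ∧
    (1 + u p ^ 2 + v p ^ 2) * partialY c p = - c p * (u p * partialY u p + v p * partialY v p) := by
  have hcp : c p ≠ 0 := by
    rintro h0
    simpa [h0] using h.self_of_nhds
  have h1 : (c * c + ((c * u) * (c * u) + (c * v) * (c * v))) =ᶠ[𝓝 p] fun _ => 1 := by
    filter_upwards [h] with q hq
    simp only [Pi.add_apply, Pi.mul_apply]
    linarith
  have hX := h1.partialX.eq_of_nhds
  have hY := h1.partialY.eq_of_nhds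
  have cu := hc.mul hu
  have cv := hc.mul hv
  rw [partialX_add (hc.mul hc) ((cu.mul cu).add (cv.mul cv)), partialX_add (cu.mul cu) (cv.mul cv),
    partialX_mul hc hc, partialX_mul cu cu, partialX_mul cv cv, partialX_mul hc hu,
    partialX_mul hc hv, partialX_const] at hX
  rw [partialY_add (hc.mul hc) ((cu.mul cu).add (cv.mul cv)), partialY_add (cu.mul cu) (cv.mul cv),
    partialY_mul hc hc, partialY_mul cu cu, partialY_mul cv cv, partialY_mul hc hu,
    partialY_mul hc hv, partialY_const] at hY
  simp only [Pi.mul_apply] at hX hY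
  constructor
  · refine mul_left_cancel₀ (mul_ne_zero two_ne_zero hcp) ?_
    linear_combination hX
  · refine mul_left_cancel₀ (mul_ne_zero two_ne_zero hcp) ?_
    linear_combination hY

/-- In (uc)_xy - u c_xy the second derivative of c cancels, and its first derivatives are given by
`mul_partial_of_scale`. -/
theorem scale_mul_harmonicDefect {u v c : ℝ × ℝ → ℝ} {p : ℝ × ℝ} (hu : AnalyticAt ℝ u p)
    (hv : AnalyticAt ℝ v p) (hc : AnalyticAt ℝ c p)
    (h : ∀ᶠ q in 𝓝 p, c q ^ 2 * (1 + u q ^ 2 + v q ^ 2) = 1) :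
    c p * harmonicDefect u v p = (1 + u p ^ 2 + v p ^ 2) *
      (partialY (partialX (u * c)) p - u p * partialY (partialX c) p) := by
  obtain ⟨hX, hY⟩ := mul_partial_of_scale hu hv hc h
  rw [partialY_partialX_mul hu hc, harmonicDefect]
  linear_combination -partialX u p * hY - partialY u p * hX

/-- With N = c (u, v, 1) and N_xy = (A, B, C), the first two components of the cross product vanish
iff B = vC and A = uC, and the third then vanishes as well. These two equations are the two defects
up to nonzero factors. -/
theorem cross_eq_zero_iff {N : ℝ × ℝ → EuclideanSpace ℝ (Fin 3)} {p : ℝ × ℝ}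
    (hN : AnalyticAt ℝ N p) (hs : ∀ᶠ q in 𝓝 p, ‖N q‖ = 1) (h3 : N p 2 ≠ 0) :
    AnalyticAt ℝ (affineU N) p ∧ AnalyticAt ℝ (affineV N) p ∧
    ((N p).ofLp ⨯₃ (partialY (partialX N) p).ofLp = 0 ↔
      harmonicDefect (affineU N) (affineV N) p = 0 ∧
      harmonicDefect (affineV N) (affineU N) p = 0) := by
  have hc := hN.euclidean_apply 2
  have hu : AnalyticAt ℝ (affineU N) p := (hN.euclidean_apply 0).div hc h3
  have hv : AnalyticAt ℝ (affineV N) p := (hN.euclidean_apply 1).div hc h3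
  refine ⟨hu, hv, ?_⟩
  have hne : ∀ᶠ q in 𝓝 p, N q 2 ≠ 0 := hc.continuousAt.eventually_ne h3
  have e0 : (fun q => N q 0) =ᶠ[𝓝 p] affineU N * fun q => N q 2 := by
    filter_upwards [hne] with q hq
    simp [affineU, hq]
  have e1 : (fun q => N q 1) =ᶠ[𝓝 p] affineV N * fun q => N q 2 := by
    filter_upwards [hne] with q hq
    simp [affineV, hq]
  have hw : ∀ᶠ q in 𝓝 p, N q 2 ^ 2 * (1 + affineU N q ^ 2 + affineV N q ^ 2) = 1 := by
    filter_upwards [hne, hs] with q hq hq1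
    have := EuclideanSpace.norm_sq_eq (N q)
    rw [hq1, Fin.sum_univ_three] at this
    simp only [Real.norm_eq_abs, sq_abs] at this
    simp only [affineU, affineV]
    field_simp
    linarith
  have hw' : ∀ᶠ q in 𝓝 p, N q 2 ^ 2 * (1 + affineV N q ^ 2 + affineU N q ^ 2) = 1 :=
    hw.mono fun q hq => by rw [add_right_comm, hq]
  have dU := scale_mul_harmonicDefect hu hv hc hw
  have dV := scale_mul_harmonicDefect hv hu hc hw'
  rw [← e0.partialX.partialY.eq_of_nhds] at dU
  rw [← e1.partialX.partialY.eq_of_nhds] at dV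
  have n0 := e0.eq_of_nhds
  have n1 := e1.eq_of_nhds
  simp only [Pi.mul_apply] at n0 n1
  have hpos : 1 + affineU N p ^ 2 + affineV N p ^ 2 ≠ 0 := by positivity
  have hpos' : 1 + affineV N p ^ 2 + affineU N p ^ 2 ≠ 0 := by positivity
  rw [cross_apply]
  simp only [partialY_partialX_euclidean_apply hN, n0, n1]
  set A := partialY (partialX fun q => N q 0) p
  set B := partialY (partialX fun q => N q 1) p
  set C := partialY (partialX fun q => N q 2) p
  constructor
  · intro h
    have h0 := congrFun h 0
    have h1 := congrFun h 1
    simp only [Matrix.cons_val_zero, Matrix.cons_val_one, Pi.zero_apply] at h0 h1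
    have hA : A - affineU N p * C = 0 := by
      refine (mul_eq_zero.1 (?_ : N p 2 * _ = 0)).resolve_left h3
      linear_combination h1
    have hB : B - affineV N p * C = 0 := by
      refine (mul_eq_zero.1 (?_ : N p 2 * _ = 0)).resolve_left h3
      linear_combination -h0
    rw [hA, mul_zero] at dU
    rw [hB, mul_zero] at dV
    exact ⟨(mul_eq_zero.1 dU).resolve_left h3, (mul_eq_zero.1 dV).resolve_left h3⟩
  · rintro ⟨h0, h1⟩
    rw [h0, mul_zero] at dU
    rw [h1, mul_zero] at dV
    have hA := (mul_eq_zero.1 dU.symm).resolve_left hpos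
    have hB := (mul_eq_zero.1 dV.symm).resolve_left hpos'
    rw [sub_eq_zero] at hA hB
    rw [hA, hB]
    funext i
    fin_cases i <;> simp <;> ring

theorem IsNormalizedHarmonicGerm.eventually {N : ℝ × ℝ → EuclideanSpace ℝ (Fin 3)}
    (hN : IsNormalizedHarmonicGerm N) : ∀ᶠ p in 𝓝 ((0, 0) : ℝ × ℝ), AnalyticAt ℝ N p ∧ ‖N p‖ = 1 ∧
      0 < N p 2 ∧ (N p).ofLp ⨯₃ (partialY (partialX N) p).ofLp = 0 := by
  obtain ⟨⟨Ω, h0, hΩ⟩, hN0⟩ := hN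
  have hpos : ∀ᶠ p in 𝓝 ((0, 0) : ℝ × ℝ), 0 < N p 2 := by
    refine ((hΩ.analytic _ h0).euclidean_apply 2).continuousAt.eventually_const_lt ?_
    simp [hN0]
  filter_upwards [hΩ.isOpen.mem_nhds h0, hpos] with p hp hp2
  exact ⟨hΩ.analytic p hp, by simpa using hΩ.mem_sphere p hp, hp2, hΩ.harmonic p hp⟩

theorem IsNormalizedHarmonicGerm.affine {N : ℝ × ℝ → EuclideanSpace ℝ (Fin 3)}
    (hN : IsNormalizedHarmonicGerm N) :
    AnalyticAt ℝ (affineU N) (0, 0) ∧ AnalyticAt ℝ (affineV N) (0, 0) ∧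
      affineU N (0, 0) = 0 ∧ affineV N (0, 0) = 0 ∧
      (∀ᶠ p in 𝓝 ((0, 0) : ℝ × ℝ), N p = sphereMap (affineU N) (affineV N) p) ∧
      (∀ᶠ p in 𝓝 ((0, 0) : ℝ × ℝ), harmonicDefect (affineU N) (affineV N) p = 0) ∧
      ∀ᶠ p in 𝓝 ((0, 0) : ℝ × ℝ), harmonicDefect (affineV N) (affineU N) p = 0 := by
  have hev := hN.eventually
  have hs : ∀ᶠ p in 𝓝 ((0, 0) : ℝ × ℝ), ‖N p‖ = 1 := hev.mono fun p hp => hp.2.1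
  have hdef : ∀ᶠ p in 𝓝 ((0, 0) : ℝ × ℝ), harmonicDefect (affineU N) (affineV N) p = 0 ∧
      harmonicDefect (affineV N) (affineU N) p = 0 := by
    filter_upwards [hev, hs.eventually_nhds] with p hp hsp
    exact (cross_eq_zero_iff hp.1 hsp hp.2.2.1.ne').2.2.1 hp.2.2.2
  have h0 := hev.self_of_nhds
  obtain ⟨hu, hv, -⟩ := cross_eq_zero_iff h0.1 hs h0.2.2.1.ne'
  refine ⟨hu, hv, by simp [affineU, hN.2], by simp [affineV, hN.2], ?_,
    hdef.mono fun p hp => hp.1, hdef.mono fun p hp => hp.2⟩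
  filter_upwards [hev] with p hp
  have h1 := EuclideanSpace.norm_sq_eq (N p)
  rw [hp.2.1, Fin.sum_univ_three] at h1
  simp only [Real.norm_eq_abs, sq_abs] at h1
  have hc := hp.2.2.1
  -- Positivity of N₃ near the origin selects the sign of the root.
  have hsqrt : Real.sqrt (1 + affineU N p ^ 2 + affineV N p ^ 2) = (N p 2)⁻¹ := by
    rw [Real.sqrt_eq_iff_eq_sq (by positivity) (by positivity)]
    simp only [affineU, affineV]
    field_simp
    linarith
  ext i
  simp only [sphereMap, hsqrt, inv_inv]
  fin_cases i <;> simp [affineU, affineV, mul_div_cancel₀, hc.ne']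

variable {u v : ℝ × ℝ → ℝ}

theorem sqrt_one_add_sq_add_sq_pos (a b : ℝ) : 0 < Real.sqrt (1 + a ^ 2 + b ^ 2) :=
  Real.sqrt_pos.2 (by positivity)

theorem affineU_sphereMap (u v : ℝ × ℝ → ℝ) : affineU (sphereMap u v) = u := by
  funext p
  have := sqrt_one_add_sq_add_sq_pos (u p) (v p)
  simp [affineU, sphereMap]
  field_simp

theorem affineV_sphereMap (u v : ℝ × ℝ → ℝ) : affineV (sphereMap u v) = v := by
  funext p
  have := sqrt_one_add_sq_add_sq_pos (u p) (v p)
  simp [affineV, sphereMap]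
  field_simp

theorem norm_sphereMap (u v : ℝ × ℝ → ℝ) (p : ℝ × ℝ) : ‖sphereMap u v p‖ = 1 := by
  have h := sqrt_one_add_sq_add_sq_pos (u p) (v p)
  rw [sphereMap, norm_smul, EuclideanSpace.norm_eq, Fin.sum_univ_three]
  simp only [norm_inv, Real.norm_eq_abs, sq_abs, abs_of_pos h]
  rw [inv_mul_eq_one₀ h.ne']
  congr 1
  simp
  ring

theorem AnalyticAt.sphereMap {p : ℝ × ℝ} (hu : AnalyticAt ℝ u p) (hv : AnalyticAt ℝ v p) :
    AnalyticAt ℝ (sphereMap u v) p := by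
  have hw : AnalyticAt ℝ (fun q => 1 + u q ^ 2 + v q ^ 2) p :=
    (analyticAt_const.add (hu.pow 2)).add (hv.pow 2)
  have hpos : 0 < 1 + u p ^ 2 + v p ^ 2 := by positivity
  have hsqrt : AnalyticAt ℝ (fun q => Real.sqrt (1 + u q ^ 2 + v q ^ 2)) p :=
    (hw.contDiffAt.sqrt hpos.ne').analyticAt
  refine (hsqrt.inv (sqrt_one_add_sq_add_sq_pos _ _).ne').smul ?_
  refine ContDiffAt.analyticAt (contDiffAt_euclidean.2 fun i => ?_)
  fin_cases i
  · exact hu.contDiffAt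
  · exact hv.contDiffAt
  · exact contDiffAt_const

theorem isNormalizedHarmonicGerm_sphereMap (hu : AnalyticAt ℝ u (0, 0))
    (hv : AnalyticAt ℝ v (0, 0)) (hu0 : u (0, 0) = 0) (hv0 : v (0, 0) = 0)
    (h1 : ∀ᶠ p in 𝓝 ((0, 0) : ℝ × ℝ), harmonicDefect u v p = 0)
    (h2 : ∀ᶠ p in 𝓝 ((0, 0) : ℝ × ℝ), harmonicDefect v u p = 0) :
    IsNormalizedHarmonicGerm (sphereMap u v) := by
  have hev : ∀ᶠ p in 𝓝 ((0, 0) : ℝ × ℝ), AnalyticAt ℝ (sphereMap u v) p ∧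
      (sphereMap u v p).ofLp ⨯₃ (partialY (partialX (sphereMap u v)) p).ofLp = 0 := by
    filter_upwards [hu.eventually_analyticAt, hv.eventually_analyticAt, h1, h2] with p hup hvp e1 e2
    refine ⟨hup.sphereMap hvp, ?_⟩
    rw [(cross_eq_zero_iff (hup.sphereMap hvp) (.of_forall fun q => norm_sphereMap u v q) ?_).2.2,
      affineU_sphereMap, affineV_sphereMap]
    · exact ⟨e1, e2⟩
    · simp [sphereMap, (sqrt_one_add_sq_add_sq_pos (u p) (v p)).ne']
  obtain ⟨Ω, hΩ, hopen, hmem⟩ := mem_nhds_iff.1 hev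
  refine ⟨⟨Ω, hmem, hopen, fun p hp => (hΩ hp).1, fun p _ => ?_, fun p hp => (hΩ hp).2⟩, ?_⟩
  · simpa using norm_sphereMap u v p
  · simp [sphereMap, hu0, hv0]

end sphere

/-! ### Jets as polynomials -/

/-- The polynomial of degree at most `n` with the coefficients `g`. -/
def truncatedPoly (n : ℕ) (g : ℕ × ℕ → ℝ) : MvPolynomial (Fin 2) ℝ :=
  ∑ k ∈ Finset.range (n + 1), ∑ i ∈ Finset.range (k + 1),
    MvPolynomial.C (g (k - i, i)) * MvPolynomial.X 0 ^ (k - i) * MvPolynomial.X 1 ^ i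

theorem jet_eq_truncatedPoly (n : ℕ) (f : ℝ × ℝ → ℝ) : jet n f = truncatedPoly n (taylor f) := rfl

theorem truncatedPoly_congr {n : ℕ} {g g' : ℕ × ℕ → ℝ}
    (h : ∀ p, totalDegree p ≤ n → g p = g' p) : truncatedPoly n g = truncatedPoly n g' := by
  refine Finset.sum_congr rfl fun k hk => Finset.sum_congr rfl fun i hi => ?_
  rw [Finset.mem_range] at hk hi
  rw [h (k - i, i) (by simp only [totalDegree]; omega)]

theorem coeff_truncatedPoly {n : ℕ} (g : ℕ × ℕ → ℝ) {p : ℕ × ℕ} (hp : totalDegree p ≤ n) :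
    (truncatedPoly n g).coeff (Finsupp.single 0 p.1 + Finsupp.single 1 p.2) = g p := by
  have hterm : ∀ k i : ℕ, MvPolynomial.C (g (k - i, i)) * MvPolynomial.X (R := ℝ) (0 : Fin 2) ^ (k - i)
      * MvPolynomial.X 1 ^ i = MvPolynomial.monomial
        (Finsupp.single 0 (k - i) + Finsupp.single 1 i) (g (k - i, i)) := by
    intro k i
    rw [MvPolynomial.X_pow_eq_monomial, MvPolynomial.X_pow_eq_monomial, MvPolynomial.C_mul_monomial,
      MvPolynomial.monomial_mul, mul_one, mul_one]
  have hinj : ∀ m l m' l' : ℕ, (Finsupp.single (0 : Fin 2) m + Finsupp.single 1 l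
      = Finsupp.single 0 m' + Finsupp.single 1 l') → m = m' ∧ l = l' := by
    intro m l m' l' h
    exact ⟨by simpa using DFunLike.congr_fun h 0, by simpa using DFunLike.congr_fun h 1⟩
  obtain ⟨m, l⟩ := p
  simp only [totalDegree] at hp
  simp only [truncatedPoly, hterm, MvPolynomial.coeff_sum, MvPolynomial.coeff_monomial]
  rw [Finset.sum_eq_single (m + l), Finset.sum_eq_single l]
  · simp
  · intro i _ hne
    exact if_neg fun h => hne (hinj _ _ _ _ h).2
  · intro h
    exact absurd (Finset.mem_range.2 (by omega)) h
  · intro k _ hne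
    refine Finset.sum_eq_zero fun i hi => if_neg fun h => hne ?_
    have := hinj _ _ _ _ h
    rw [Finset.mem_range] at hi
    omega
  · intro h
    exact absurd (Finset.mem_range.2 (by omega)) h

/-- The only mixed monomial below degree 3 is xy, and its coefficient vanishes by `h1`. -/
theorem truncatedPoly_eq {n : ℕ} {g : ℕ × ℕ → ℝ} (h0 : g 0 = 0) (h1 : g (1, 1) = 0) :
    truncatedPoly n g = (∑ k ∈ Finset.Icc 1 n, MvPolynomial.C (g (k, 0)) * MvPolynomial.X 0 ^ k)
      + (∑ k ∈ Finset.Icc 1 n, MvPolynomial.C (g (0, k)) * MvPolynomial.X 1 ^ k)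
      + ∑ k ∈ Finset.Icc 3 n, ∑ i ∈ Finset.Icc 1 (k - 1),
        MvPolynomial.C (g (k - i, i)) * MvPolynomial.X 0 ^ (k - i) * MvPolynomial.X 1 ^ i := by
  have hrange : Finset.range (n + 1) = insert 0 (Finset.Icc 1 n) := by
    ext k
    simp only [Finset.mem_range, Finset.mem_insert, Finset.mem_Icc]
    omega
  have hmix : ∑ k ∈ Finset.Icc 3 n, ∑ i ∈ Finset.Icc 1 (k - 1),
        MvPolynomial.C (g (k - i, i)) * MvPolynomial.X (0 : Fin 2) ^ (k - i) * MvPolynomial.X 1 ^ i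
      = ∑ k ∈ Finset.Icc 1 n, ∑ i ∈ Finset.Icc 1 (k - 1),
        MvPolynomial.C (g (k - i, i)) * MvPolynomial.X 0 ^ (k - i) * MvPolynomial.X 1 ^ i := by
    refine Finset.sum_subset (Finset.Icc_subset_Icc_left (by norm_num)) fun k hk hk3 => ?_
    rw [Finset.mem_Icc] at hk hk3
    refine Finset.sum_eq_zero fun i hi => ?_
    rw [Finset.mem_Icc] at hi
    obtain ⟨rfl, rfl⟩ : k = 2 ∧ i = 1 := by omega
    simp [h1]
  rw [hmix, ← Finset.sum_add_distrib, ← Finset.sum_add_distrib, truncatedPoly, hrange,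
    Finset.sum_insert (by simp)]
  have h0' : g (0, 0) = 0 := h0
  simp only [zero_add, Finset.range_one, Finset.sum_singleton, h0', map_zero, zero_mul,
    Nat.sub_zero]
  refine Finset.sum_congr rfl fun k hk => ?_
  rw [Finset.mem_Icc] at hk
  have hk' : Finset.range (k + 1) = insert 0 (insert k (Finset.Icc 1 (k - 1))) := by
    ext i
    simp only [Finset.mem_range, Finset.mem_insert, Finset.mem_Icc]
    omega
  rw [hk', Finset.sum_insert (by simp; omega), Finset.sum_insert (by simp; omega)]
  simp [add_assoc]

/-! ### The normal form -/

/-- The polynomials `P k i` expressing the mixed coefficients through the pure ones. -/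
def mixedPoly (k i : ℕ) : MvPolynomial (Fin 4 × ℕ) ℝ :=
  if 1 ≤ i ∧ i < k then harmonicSolution universalData (k - i, i) else 0

/-- The default value 0 outside 1 ≤ i < k has no variables, so the bound needs no condition on k and
i. -/
theorem vars_mixedPoly (k i : ℕ) : ∀ q ∈ (mixedPoly k i).vars, 1 ≤ q.2 ∧ q.2 + 2 ≤ k := by
  intro q hq
  unfold mixedPoly at hq
  split_ifs at hq with h
  · have := vars_harmonicSolution_universalData (p := (k - i, i)) (by simp; omega) (by simp; omega) hq
    simp only [totalDegree] at this
    omega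
  · simp at hq

/-- The parameters as pure coefficients for the recursion. -/
def PureParams.data {n : ℕ} (c : PureParams n) (s : Fin 4) (l : ℕ) : ℝ := c.val (s, l)

theorem PureParams.data_swap {n : ℕ} (c : PureParams n) : c.swap.data = swapData c.data := by
  funext s l
  fin_cases s <;> rfl

theorem PureParams.data_succ {n : ℕ} (c : PureParams n) (s : Fin 4) (j : Fin n) :
    c.data s (j + 1) = c s j := by
  have : 1 ≤ (j : ℕ) + 1 ∧ (j : ℕ) + 1 ≤ n := by omega
  simp [PureParams.data, PureParams.val, this]

theorem eval_mixedPoly {n : ℕ} (c : PureParams n) {k i : ℕ} (h : 1 ≤ i ∧ i < k) :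
    MvPolynomial.eval c.val (mixedPoly k i) = harmonicSolution c.data (k - i, i) := by
  rw [mixedPoly, if_pos h, ← MvPolynomial.coe_aeval_eq_eval]
  refine (map_harmonicSolution (MvPolynomial.aeval c.val) universalData _).trans ?_
  congr 1
  funext s l
  simp [universalData, PureParams.data]

theorem harmonicSolution_fst_succ (d : Fin 4 → ℕ → ℝ) (m : ℕ) :
    harmonicSolution d (m + 1, 0) = d 0 (m + 1) := by
  rw [← harmonicStep_harmonicSolution]
  rfl

theorem harmonicSolution_snd_succ (d : Fin 4 → ℕ → ℝ) (n : ℕ) :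
    harmonicSolution d (0, n + 1) = d 1 (n + 1) := by
  rw [← harmonicStep_harmonicSolution]
  rfl

theorem normalForm_mixedPoly {n : ℕ} (c : PureParams n) :
    normalForm mixedPoly n c = truncatedPoly n (harmonicSolution c.data) := by
  rw [truncatedPoly_eq (harmonicSolution_zero _) (harmonicSolution_one_one _), normalForm]
  congr 1
  · congr 1
    · refine Finset.sum_congr rfl fun k hk => ?_
      obtain ⟨k, rfl⟩ := Nat.exists_eq_add_of_le' (Finset.mem_Icc.1 hk).1
      rw [harmonicSolution_fst_succ, PureParams.data]
    · refine Finset.sum_congr rfl fun k hk => ?_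
      obtain ⟨k, rfl⟩ := Nat.exists_eq_add_of_le' (Finset.mem_Icc.1 hk).1
      rw [harmonicSolution_snd_succ, PureParams.data]
  · refine Finset.sum_congr rfl fun k hk => Finset.sum_congr rfl fun i hi => ?_
    rw [Finset.mem_Icc] at hk hi
    rw [eval_mixedPoly c (by omega)]

theorem normalFormPair_mixedPoly {n : ℕ} (c : PureParams n) : normalFormPair mixedPoly n c =
    (truncatedPoly n (harmonicSolution c.data),
      truncatedPoly n (harmonicSolution (swapData c.data))) := by
  rw [normalFormPair, normalForm_mixedPoly, normalForm_mixedPoly, PureParams.data_swap]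

theorem swapData_congr {d d' : Fin 4 → ℕ → ℝ} {l : ℕ} (h : ∀ s, d s l = d' s l) (s : Fin 4) :
    swapData d s l = swapData d' s l := by
  fin_cases s
  exacts [h 2, h 3, h 0, h 1]

/-- A germ may have infinitely many nonzero pure coefficients, while `pureCoeffs` keeps those of
degree 1 to n; the n-jet cannot tell the two apart. -/
theorem harmonicIter_congr_data {n : ℕ} (K : ℕ) : ∀ {d d' : Fin 4 → ℕ → ℝ},
    (∀ s l, 1 ≤ l → l ≤ n → d s l = d' s l) → ∀ p, totalDegree p ≤ n →
    harmonicIter d K p = harmonicIter d' K p := by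
  induction K with
  | zero => intros; rfl
  | succ K ih =>
    intro d d' h p hp
    have hswap : ∀ s l, 1 ≤ l → l ≤ n → swapData d s l = swapData d' s l :=
      fun s l h1 h2 => swapData_congr (fun s => h s l h1 h2) s
    obtain ⟨_ | m, _ | l⟩ := p
    · rfl
    · exact h 1 (l + 1) (by omega) (by simpa [totalDegree] using hp)
    · exact h 0 (m + 1) (by omega) (by simpa [totalDegree] using hp)
    · simp only [harmonicIter, harmonicStep]
      rw [harmonicCubic_congr (harmonicIter_zero _ _) (harmonicIter_zero _ _)
        (harmonicIter_zero _ _) (harmonicIter_zero _ _) fun q hq =>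
        ⟨ih h q (by omega), ih hswap q (by omega)⟩]

theorem IsNormalizedHarmonicGerm.jetPair_eq {N : ℝ × ℝ → EuclideanSpace ℝ (Fin 3)}
    (hN : IsNormalizedHarmonicGerm N) (n : ℕ) :
    jetPair n N = normalFormPair mixedPoly n (pureCoeffs n N) := by
  obtain ⟨hu, hv, hu0, hv0, -, e1, e2⟩ := hN.affine
  set d : Fin 4 → ℕ → ℝ := ![fun l => taylor (affineU N) (l, 0), fun l => taylor (affineU N) (0, l),
    fun l => taylor (affineV N) (l, 0), fun l => taylor (affineV N) (0, l)] with hd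
  obtain ⟨s1, s2⟩ := eq_harmonicSolution (d := d)
    (taylor_eq_harmonicStep hu hv hu0 e1 (fun _ => rfl) fun _ => rfl)
    (taylor_eq_harmonicStep hv hu hv0 e2 (fun _ => rfl) fun _ => rfl)
  have hdata : ∀ s l, 1 ≤ l → l ≤ n → d s l = (pureCoeffs n N).data s l := by
    intro s l h1 h2
    obtain ⟨l, rfl⟩ := Nat.exists_eq_add_of_le' h1
    rw [(pureCoeffs n N).data_succ s ⟨l, h2⟩]
    fin_cases s <;> simp [hd, pureCoeffs, taylorCoeff_eq_taylor]
  have hdata' : ∀ s l, 1 ≤ l → l ≤ n → swapData d s l = swapData (pureCoeffs n N).data s l :=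
    fun s l h1 h2 => swapData_congr (fun s => hdata s l h1 h2) s
  rw [normalFormPair_mixedPoly, jetPair, jet_eq_truncatedPoly, jet_eq_truncatedPoly, s1, s2]
  exact Prod.ext (truncatedPoly_congr fun p hp => harmonicIter_congr_data _ hdata p hp)
    (truncatedPoly_congr fun p hp => harmonicIter_congr_data _ hdata' p hp)

/-- The pure coefficients beyond degree n are chosen to be zero, which is the finiteness that the
convergence estimate requires. -/
theorem exists_isNormalizedHarmonicGerm {n : ℕ} (c : PureParams n) :
    ∃ N : ℝ × ℝ → EuclideanSpace ℝ (Fin 3), IsNormalizedHarmonicGerm N ∧ pureCoeffs n N = c := by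
  have hfin : ∀ s l, n < l → c.data s l = 0 := fun s l hl => by
    have : ¬ (1 ≤ l ∧ l ≤ n) := by omega
    simp [PureParams.data, PureParams.val, this]
  have hfin' : ∀ s l, n < l → swapData c.data s l = 0 := fun s l hl => by
    fin_cases s <;> exact hfin _ l hl
  obtain ⟨ρ, hρ, hbound⟩ := exists_abs_harmonicSolution_le hfin
  obtain ⟨ρ', hρ', hbound'⟩ := exists_abs_harmonicSolution_le hfin'
  obtain ⟨u, hu, hTu⟩ := exists_analyticAt_taylor_eq hρ hbound
  obtain ⟨v, hv, hTv⟩ := exists_analyticAt_taylor_eq hρ' hbound'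
  have hu0 : u (0, 0) = 0 := by
    rw [← taylor_zero_zero u, hTu]
    exact harmonicSolution_zero _
  have hv0 : v (0, 0) = 0 := by
    rw [← taylor_zero_zero v, hTv]
    exact harmonicSolution_zero _
  have e1 : taylor u = harmonicStep c.data (taylor u) (taylor v) := by
    rw [hTu, hTv, harmonicStep_harmonicSolution]
  have e2 : taylor v = harmonicStep (swapData c.data) (taylor v) (taylor u) := by
    have := harmonicStep_harmonicSolution (swapData c.data)
    rw [swapData_swapData] at this
    rw [hTu, hTv, this]
  refine ⟨sphereMap u v, isNormalizedHarmonicGerm_sphereMap hu hv hu0 hv0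
    (harmonicDefect_eventually_eq_zero hu hv e1) (harmonicDefect_eventually_eq_zero hv hu e2), ?_⟩
  funext s j
  rw [← c.data_succ]
  fin_cases s <;>
    simp [pureCoeffs, affineU_sphereMap, affineV_sphereMap, taylorCoeff_eq_taylor, hTu, hTv,
      harmonicSolution_fst_succ, harmonicSolution_snd_succ, swapData]

/-- The parameters are themselves coefficients of the two polynomials, namely those of the pure
powers. -/
theorem normalFormPair_mixedPoly_injective (n : ℕ) :
    Function.Injective (normalFormPair mixedPoly n) := by
  intro c c' h
  rw [normalFormPair_mixedPoly, normalFormPair_mixedPoly, Prod.mk.injEq] at h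
  have h1 : ∀ p, totalDegree p ≤ n → harmonicSolution c.data p = harmonicSolution c'.data p := by
    intro p hp
    rw [← coeff_truncatedPoly (harmonicSolution c.data) hp, h.1, coeff_truncatedPoly _ hp]
  have h2 : ∀ p, totalDegree p ≤ n →
      harmonicSolution (swapData c.data) p = harmonicSolution (swapData c'.data) p := by
    intro p hp
    rw [← coeff_truncatedPoly (harmonicSolution (swapData c.data)) hp, h.2,
      coeff_truncatedPoly _ hp]
  funext s j
  have hj : totalDegree ((j : ℕ) + 1, 0) ≤ n := j.2
  have hj' : totalDegree (0, (j : ℕ) + 1) ≤ n := by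
    simp only [totalDegree]
    omega
  rw [← c.data_succ, ← c'.data_succ]
  fin_cases s
  · exact (harmonicSolution_fst_succ _ _).symm.trans ((h1 _ hj).trans (harmonicSolution_fst_succ _ _))
  · exact (harmonicSolution_snd_succ _ _).symm.trans ((h1 _ hj').trans (harmonicSolution_snd_succ _ _))
  · exact (harmonicSolution_fst_succ _ _).symm.trans ((h2 _ hj).trans (harmonicSolution_fst_succ _ _))
  · exact (harmonicSolution_snd_succ _ _).symm.trans ((h2 _ hj').trans (harmonicSolution_snd_succ _ _))

end

theorem theorem2p3 :
    -- every normalized germ is `δ (u, v, 1)` with `u`, `v` analytic and vanishing at the origin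
    (∀ N : ℝ × ℝ → EuclideanSpace ℝ (Fin 3), IsNormalizedHarmonicGerm N →
      AnalyticAt ℝ (affineU N) (0, 0) ∧ AnalyticAt ℝ (affineV N) (0, 0) ∧
      affineU N (0, 0) = 0 ∧ affineV N (0, 0) = 0 ∧
      ∀ᶠ p in 𝓝 ((0, 0) : ℝ × ℝ), N p = sphereMap (affineU N) (affineV N) p) ∧
    ∃ P : ℕ → ℕ → MvPolynomial (Fin 4 × ℕ) ℝ,
      -- `P k i` involves only `a_{l0}, a_{ll}, b_{l0}, b_{ll}` with `1 ≤ l ≤ k - 2`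
      (∀ k i : ℕ, ∀ q ∈ (P k i).vars, 1 ≤ q.2 ∧ q.2 + 2 ≤ k) ∧
      ∀ n : ℕ,
        -- the `n`-jet of a germ is determined polynomially by its pure coefficients
        (∀ N : ℝ × ℝ → EuclideanSpace ℝ (Fin 3), IsNormalizedHarmonicGerm N →
          jetPair n N = normalFormPair P n (pureCoeffs n N)) ∧
        -- all pure coefficients occur
        (∀ c : PureParams n, ∃ N : ℝ × ℝ → EuclideanSpace ℝ (Fin 3),
          IsNormalizedHarmonicGerm N ∧ pureCoeffs n N = c ∧
          jetPair n N = normalFormPair P n c) ∧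
        -- the `n`-jet space is parametrized by `ℝ^{4n}`
        Set.BijOn (normalFormPair P n) Set.univ (jetSpace n) := by
  refine ⟨fun N hN => ?_, mixedPoly, vars_mixedPoly, fun n => ⟨fun N hN => hN.jetPair_eq n, ?_, ?_⟩⟩
  · obtain ⟨hu, hv, hu0, hv0, hs, -⟩ := hN.affine
    exact ⟨hu, hv, hu0, hv0, hs⟩
  · intro c
    obtain ⟨N, hN, hc⟩ := exists_isNormalizedHarmonicGerm c
    exact ⟨N, hN, hc, by rw [hN.jetPair_eq, hc]⟩
  · refine ⟨fun c _ => ?_, (normalFormPair_mixedPoly_injective n).injOn, ?_⟩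
    · obtain ⟨N, hN, hc⟩ := exists_isNormalizedHarmonicGerm c
      exact ⟨N, hN, by rw [hN.jetPair_eq, hc]⟩
    · rintro J ⟨N, hN, rfl⟩
      exact ⟨pureCoeffs n N, trivial, (hN.jetPair_eq n).symm⟩
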